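/- Let $(R,\mathfrak m,k)$ be a one-dimensional Noetherian local domain with infinite residue field $k$ and quotient field $K$. Assume that the integral closure $\overline R$ of $R$ in $K$ is a finite $R$-module and a discrete valuation ring with valuation $v$, and that the natural map $k\to\overline R/t\overline R$ ($t$ a uniformizer) is an isomorphism. Write $\ell$ for length over $R$; for $R$-submodules $L,N$ of $K$ put $L:N=\{z\in K\mid zN\subseteq L\}$ and $L^{*}=R:L$. Let $\gamma_R=R:\overline R$, $c=\ell(\overline R/\gamma_R)$, $n=\ell(R/\gamma_R)$; let $0=s_0<s_1<\cdots$ be the elements of the semigroup $v(R\setminus\{0\})$, let $R_i=\{a\in R\mid v(a)\ge s_i\}$ and $r_i=\ell\big((R:R_i)/(R:R_{i-1})\big)$ for $1\le i\le n$. Assume that $R$ is almost Gorenstein, that is, its type sequence $[r_1,\dots,r_n]$ is $[r,1,\dots,1]$, where $r=r_1$ is the Cohen–Macaulay type. Let $\omega$ be a canonical ideal of $R$ (a nonzero fractional ideal with $\omega:(\omega:J)=J$ for all nonzero fractional ideals $J$), normalized by $R\subseteq\omega\subseteq\overline R$; such an $\omega$ exists. Let $I$ be an $\mathfrak m$-primary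 ideal of $R$ that is not principal, let $h_I(z)\in\mathbb Z[z]$ be the polynomial with $\sum_{j\ge0}\ell(I^j/I^{j+1})z^j=h_I(z)/(1-z)$, and let $e=h_I(1)$ and $\rho=h_I'(1)$ be the multiplicity and the genus of $I$. Let $x\in I$ be a minimal reduction of $I$, that is, $I^{j+1}=xI^j$ for all large $j$ (such an $x$ exists), and let $\nu$ be the reduction exponent: the least integer with $I^{j+1}=xI^j$ for all $j\ge\nu$. Let $\Lambda=\bigcup_{j\ge0}(I^j:I^j)$ be the blowing-up of $R$ along $I$, and $c_\Lambda=\ell(\overline R/(\Lambda:\overline R))$. All the lengths occurring here are finite, and: 1. $2\rho=e\nu+r-1-\ell\big((R:\Lambda)/I^\nu\big)-\ell(\Lambda^{**}/\Lambda)$; in particular $2\rho\le e\nu+r-1$. 2. The following conditions are equivalent: (a) $2\rho=e\nu+r-1$; (b) $\Lambda$ is Gorenstein and $c-c_\Lambda=e\nu$; (c) $R:\Lambda=I^\nu$; (d) $\omega:\Lambda=I^\nu$. If they hold, then all of the following hold: $(A_1)$ $\omega\subseteq\Lambda$; $(A_2)$ $\omega\Lambda=\Lambda$; $(A_3)$ $\omega:\Lambda=R:\Lambda$;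 $(A_4)$ $I^j=I^j\omega\cap R$ for all $j\ge\nu$; $(A_5)$ $\omega I^j=I^j$ for all $j\ge\nu$; $(A_6)$ $\omega I^j=I^j$ for some $j>0$. -/

import Mathlib

open scoped nonZeroDivisors Polynomial PowerSeries

namespace CurveBlowup

noncomputable section

/-- The length `ℓ_R(L / N)` for submodules `N ⊆ L` of a module. -/
def len {R M : Type*} [CommRing R] [AddCommGroup M] [Module R M] (L N : Submodule R M) : ℕ∞ :=
  Module.length R (L ⧸ N.submoduleOf L)

section Hilbert

variable {R : Type*} [CommRing R]

/-- The Hilbert function `H_I(n) = ℓ_R(I^n / I^(n+1))`. -/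
def hilbertFn (I : Ideal R) (n : ℕ) : ℕ∞ := len (I ^ n) (I ^ (n + 1))

/-- The Hilbert-Poincaré series `P_I(z) = ∑ H_I(n) z^n`. -/
def hilbertSeries (I : Ideal R) : ℤ⟦X⟧ := PowerSeries.mk fun n => ((hilbertFn I n).toNat : ℤ)

/-- `p` is the `h`-polynomial of `I`: `P_I(z) = p(z) / (1 - z)`. -/
def IsHPolynomial (I : Ideal R) (p : ℤ[X]) : Prop :=
  (p : ℤ⟦X⟧) = (1 - PowerSeries.X) * hilbertSeries I

open Classical in
/-- The `h`-polynomial of `I` (there is at most one polynomial as in `IsHPolynomial`). -/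
def hPolynomial (I : Ideal R) : ℤ[X] :=
  if h : ∃ p : ℤ[X], IsHPolynomial I p then h.choose else 0

/-- The multiplicity `e(I) = h_I(1)`. -/
def idealMult (I : Ideal R) : ℤ := (hPolynomial I).eval 1

/-- The genus `ρ(I) = h_I'(1)`. -/
def genus (I : Ideal R) : ℤ := (Polynomial.derivative (hPolynomial I)).eval 1

/-- `x ∈ I` is a minimal reduction of `I`: `I^(n+1) = x I^n` for all large `n`. -/
def IsMinimalReduction (I : Ideal R) (x : R) : Prop :=
  x ∈ I ∧ ∃ m : ℕ, ∀ n ≥ m, I ^ (n + 1) = Ideal.span {x} * I ^ n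

/-- The reduction exponent: the least `m` with `I^(n+1) = x I^n` for all `n ≥ m`. -/
def reductionExponent (I : Ideal R) (x : R) : ℕ :=
  sInf {m : ℕ | ∀ n ≥ m, I ^ (n + 1) = Ideal.span {x} * I ^ n}

end Hilbert

section Fractional

variable {R : Type*} [CommRing R] (K : Type*) [Field K] [Algebra R K]

/-- An ideal of `R`, seen inside `K`. In `Submodule R K`, the quotient `L / N` is the colon
`L : N = {z ∈ K | z N ⊆ L}`, and `1` is `R`. -/
abbrev inK (I : Ideal R) : Submodule R K := IsLocalization.coeSubmodule K I

theorem colon_self_succ (L : Submodule R K) (n : ℕ) : L ^ n / L ^ n ≤ L ^ (n + 1) / L ^ (n + 1) := by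
  rw [Submodule.le_div_iff_mul_le, pow_succ, ← mul_assoc]
  exact mul_le_mul_left (Submodule.le_div_iff_mul_le.mp le_rfl) L

theorem colon_self_mono (L : Submodule R K) : Monotone fun n : ℕ => L ^ n / L ^ n :=
  monotone_nat_of_le_succ (colon_self_succ K L)

/-- The blowing-up `Λ(I) = ⋃ₙ (I^n : I^n)` of `R` along `I`, a ring between `R` and `K`. -/
def blowup (I : Ideal R) : Subalgebra R K where
  carrier := {z | ∃ n : ℕ, z ∈ inK K I ^ n / inK K I ^ n}
  mul_mem' := by
    rintro a b ⟨n, ha⟩ ⟨m, hb⟩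
    refine ⟨max n m, ?_⟩
    have ha' := colon_self_mono K (inK K I) (le_max_left n m) ha
    have hb' := colon_self_mono K (inK K I) (le_max_right n m) hb
    rw [Submodule.mem_div_iff_forall_mul_mem] at *
    intro y hy
    rw [mul_assoc]
    exact ha' _ (hb' y hy)
  add_mem' := by
    rintro a b ⟨n, ha⟩ ⟨m, hb⟩
    exact ⟨max n m, Submodule.add_mem _ (colon_self_mono K (inK K I) (le_max_left n m) ha)
      (colon_self_mono K (inK K I) (le_max_right n m) hb)⟩
  algebraMap_mem' := by
    intro r
    refine ⟨0, ?_⟩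
    rw [Submodule.mem_div_iff_forall_mul_mem]
    intro y hy
    rw [← Algebra.smul_def]
    exact Submodule.smul_mem _ r hy

/-- The blowing-up `Λ(I)` as an `R`-submodule of `K`. -/
abbrev blowupMod (I : Ideal R) : Submodule R K := Subalgebra.toSubmodule (blowup K I)

/-- The dual `L* = R : L`. -/
abbrev starDual (L : Submodule R K) : Submodule R K := 1 / L

variable (R)

/-- The integral closure of `R` in `K`, as a submodule of `K`. -/
abbrev normalization : Submodule R K := Subalgebra.toSubmodule (integralClosure R K)

/-- `W` is a canonical (fractional) ideal of `R`, in the sense of Herzog and Kunz: a nonzero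
fractional ideal with `W : (W : J) = J` for every nonzero fractional ideal `J`. -/
def IsCanonicalIdeal (W : Submodule R K) : Prop :=
  W ≠ ⊥ ∧ IsFractional R⁰ W ∧
    ∀ J : Submodule R K, J ≠ ⊥ → IsFractional R⁰ J → W / (W / J) = J

/-- A canonical ideal `ω`, normalized by `R ⊆ ω ⊆ R̄`. -/
def IsNormalizedCanonicalIdeal (W : Submodule R K) : Prop :=
  IsCanonicalIdeal R K W ∧ 1 ≤ W ∧ W ≤ normalization R K

/-- `R`, a one-dimensional Noetherian local domain with quotient field `K`, is Gorenstein: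
it is a canonical ideal of itself. -/
def IsGorenstein : Prop := IsCanonicalIdeal R K 1

/-- The conductor of `R` in `R̄`: `γ_R = R : R̄`. -/
def conductorIdeal : Submodule R K := 1 / normalization R K

/-- `c = ℓ_R(R̄ / γ_R)`. -/
def condLen : ℕ∞ := len (normalization R K) (conductorIdeal R K)

variable {R} in
/-- `c_Λ = ℓ_R(R̄ / γ_Λ)`, where `γ_Λ = Λ : R̄` and `Λ = Λ(I)`. -/
def condLenBlowup (I : Ideal R) : ℕ∞ :=
  len (normalization R K) (blowupMod K I / normalization R K)

variable {R} in
/-- The conditions (A₁)–(A₆) for the blowing-up `Λ` of `R` along `I`, with reduction exponent `ν`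
and canonical ideal `ω`, all of them together. In (A₄), `I^n ω ∩ R` is the canonical closure
of `I^n`. -/
structure ConditionsA (I : Ideal R) (ν : ℕ) (ω : Submodule R K) : Prop where
  a1 : ω ≤ blowupMod K I
  a2 : ω * blowupMod K I = blowupMod K I
  a3 : ω / blowupMod K I = 1 / blowupMod K I
  a4 : ∀ n ≥ ν, inK K (I ^ n) = inK K (I ^ n) * ω ⊓ 1
  a5 : ∀ n ≥ ν, ω * inK K (I ^ n) = inK K (I ^ n)
  a6 : ∃ n > 0, ω * inK K (I ^ n) = inK K (I ^ n)

variable [IsDiscreteValuationRing (integralClosure R K)]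

/-- The valuation of `R̄`, normalized by `v(t) = 1`, restricted to `R`. -/
def val (a : R) : ℕ∞ :=
  IsDiscreteValuationRing.addVal (integralClosure R K) (algebraMap R (integralClosure R K) a)

/-- The numerical semigroup `v(R)`. -/
def valueSemigroup : Set ℕ := {s | ∃ a : R, val R K a = s}

/-- The elements `s₀ = 0 < s₁ < s₂ < ⋯` of `v(R)` in increasing order. -/
def semigroupElt (i : ℕ) : ℕ := Nat.nth (· ∈ valueSemigroup R K) i

/-- The ideal `R_i = {a ∈ R | v(a) ≥ s_i}`. -/
def valIdeal (i : ℕ) : Ideal R where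
  carrier := {a | (semigroupElt R K i : ℕ∞) ≤ val R K a}
  zero_mem' := by simp [val]
  add_mem' := by
    intro a b ha hb
    simp only [Set.mem_ofPred_eq, val, map_add] at *
    exact le_trans (le_min ha hb) (AddValuation.map_add _ _ _)
  smul_mem' := by
    intro c a ha
    simp only [Set.mem_ofPred_eq, val, smul_eq_mul, map_mul] at *
    rw [AddValuation.map_mul]
    exact le_trans ha le_add_self

/-- The entry `r_i = ℓ_R((R : R_i) / (R : R_(i-1)))` of the type sequence `[r_1, …, r_n]`,
for `1 ≤ i ≤ n = ℓ_R(R / γ_R)`. -/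
def typeSeq (i : ℕ) : ℕ∞ :=
  len (1 / inK K (valIdeal R K i)) (1 / inK K (valIdeal R K (i - 1)))

/-- The Cohen-Macaulay type `r = r_1`. -/
def cmType : ℕ∞ := typeSeq R K 1

/-- `R` is almost Gorenstein: its type sequence is `[r_1, 1, …, 1]`. -/
def IsAlmostGorenstein : Prop :=
  ∀ i : ℕ, 2 ≤ i → (i : ℕ∞) ≤ len 1 (conductorIdeal R K) → typeSeq R K i = 1

end Fractional

end

end CurveBlowup

open CurveBlowup

/-! Everything rests on one identity: with `d = x^ν`, `I^ν = dΛ` inside `K`. For `n ≥ ν`, `I^n = x^n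
Λ`, so the Hilbert function is constant there with value `e = ℓ(Λ/xΛ)`; hence `eν = ℓ(Λ/I^ν)` and `ρ
= eν - ℓ(R/I^ν) = ℓ(Λ/R)` (`isHPolynomial_and_idealMult_genus_eq`).

Almost Gorensteinness enters through `ω`. Telescoping the type sequence gives `ℓ(R̄/R) = ℓ(R/γ) + r
- 1`, and `ω`-duality turns this into `ℓ(ω/R) = r - 1`, then into `ω𝔪 = 𝔪`. Since `Λ ≠ R`, the
`Λ`-module `Λ*` lies in `𝔪`, so `ωΛ* = Λ*` (`mul_one_div`). Therefore `Λ** = ω : Λ*`, and duality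
yields `ℓ(Λ**/R) = ℓ(R/Λ*) + r - 1` (`lenNat_bidual`). Adding lengths along `I^ν ⊆ Λ* ⊆ R ⊆ Λ ⊆ Λ**`
proves formula 1.

Equality in the bound forces `Λ* = I^ν`. Conversely `Λ* = dΛ` implies `Λ** = d⁻¹Λ* = Λ`, so both
correction terms vanish. It also gives `ωΛ = Λ`, from which (d) and the conditions (A) follow.
Finally `ω : Λ` is a canonical ideal of `Λ`: if it is `dΛ`, then `Λ` is Gorenstein and `γ_R = dγ_Λ`;
if `Λ` is Gorenstein, it is some `cΛ ⊇ dΛ`, and the conductor lengths decide whether equality holds.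

Existence of `ω` is proved by a Zorn argument producing `W` with `K/W` of simple socle; a minimal
reduction is an element of least value in `I`. -/

set_option linter.unusedSectionVars false

namespace CurveBlowup

/-! ### Lengths of subquotients. -/

section Length

variable {R M M' : Type*} [CommRing R] [AddCommGroup M] [Module R M] [AddCommGroup M'] [Module R M']

/-- Submodules of `L / N` correspond to submodules between `N` and `L`. -/
def quotientOrderIsoIcc {L N : Submodule R M} (h : N ≤ L) :
    Submodule R (L ⧸ N.submoduleOf L) ≃o Set.Icc N L :=
  (Submodule.comapMkQRelIso _).trans
    { toFun := fun P => ⟨P.1.map L.subtype, by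
        have := Submodule.map_mono (f := L.subtype) (show N.comap L.subtype ≤ P.1 from P.2)
        rwa [Submodule.map_comap_subtype, inf_eq_right.mpr h] at this,
        Submodule.map_subtype_le _ _⟩
      invFun := fun X => ⟨X.1.comap L.subtype, Submodule.comap_mono X.2.1⟩
      left_inv := fun P => Subtype.ext
        (Submodule.comap_map_eq_of_injective L.injective_subtype _)
      right_inv := fun X => Subtype.ext (by
        simpa [Submodule.map_comap_subtype] using X.2.2)
      map_rel_iff' := fun {P Q} => by
        change Submodule.map L.subtype P.1 ≤ Submodule.map L.subtype Q.1 ↔ P.1 ≤ Q.1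
        exact Submodule.map_le_map_iff_of_injective L.injective_subtype _ _ }

theorem coe_len {L N : Submodule R M} (h : N ≤ L) :
    (len L N : WithBot ℕ∞) = Order.krullDim (Set.Icc N L) := by
  rw [len, Module.coe_length, Order.krullDim_eq_of_orderIso (quotientOrderIsoIcc h)]

/-- Length is the Krull dimension of the interval `[N, L]`, which does not change when the order is
reversed. Hence an order-reversing duality preserves length without any module isomorphism. -/
theorem len_eq_of_orderIso_dual {L N : Submodule R M} {L' N' : Submodule R M'} (h : N ≤ L)
    (h' : N' ≤ L') (f : Set.Icc N L ≃o (Set.Icc N' L')ᵒᵈ) : len L N = len L' N' := by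
  have := Order.krullDim_eq_of_orderIso f
  rw [Order.krullDim_orderDual, ← coe_len h, ← coe_len h'] at this
  exact_mod_cast this

theorem len_add {A B C : Submodule R M} (hCB : C ≤ B) (hBA : B ≤ A) :
    len A C = len B C + len A B := by
  refine Module.length_eq_add_of_exact
    (Submodule.mapQ (C.submoduleOf B) (C.submoduleOf A) (Submodule.inclusion hBA) le_rfl)
    (Submodule.factor (Submodule.comap_mono hCB)) ?_ (Submodule.factor_surjective _) ?_
  · rw [← LinearMap.ker_eq_bot]
    exact Submodule.ker_liftQ_eq_bot _ _ _ fun x hx =>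
      (Submodule.Quotient.mk_eq_zero (C.submoduleOf A)).mp hx
  · rw [LinearMap.exact_iff]
    ext z
    obtain ⟨z, rfl⟩ := Submodule.mkQ_surjective _ z
    constructor
    · intro hz
      have hz' : (z : M) ∈ B := (Submodule.Quotient.mk_eq_zero (B.submoduleOf A)).mp hz
      exact ⟨Submodule.Quotient.mk ⟨z, hz'⟩, rfl⟩
    · rintro ⟨y, hy⟩
      obtain ⟨y, rfl⟩ := Submodule.mkQ_surjective _ y
      rw [← hy]
      exact (Submodule.Quotient.mk_eq_zero (B.submoduleOf A)).mpr y.2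

theorem len_self (L : Submodule R M) : len L L = 0 := by
  rw [len, Module.length_eq_zero_iff, Submodule.Quotient.subsingleton_iff,
    Submodule.submoduleOf_self]

theorem le_of_len_eq_zero {L N : Submodule R M} (h : len L N = 0) : L ≤ N := by
  rwa [len, Module.length_eq_zero_iff, Submodule.Quotient.subsingleton_iff,
    Submodule.submoduleOf_eq_top] at h

theorem len_mono {L L' N N' : Submodule R M} (hN : N' ≤ N) (h : N ≤ L) (hL : L ≤ L') :
    len L N ≤ len L' N' := by
  rw [len_add (hN.trans h) hL, len_add hN h, add_assoc, add_left_comm]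
  exact le_self_add

theorem len_eq_one_of_covBy {L N : Submodule R M} (h : N ⋖ L) : len L N = 1 :=
  Module.length_eq_one_iff.mpr ((covBy_iff_quot_is_simple h.le).mp h)

theorem len_map {f : M →ₗ[R] M'} (hf : Function.Injective f) (L N : Submodule R M) :
    len (L.map f) (N.map f) = len L N := by
  refine (LinearEquiv.length_eq (Submodule.Quotient.equiv _ _
    (Submodule.equivMapOfInjective f hf L) ?_)).symm
  ext ⟨y, hy⟩
  simp only [Submodule.submoduleOf, Submodule.mem_map, Submodule.mem_comap]
  constructor
  · rintro ⟨x, hx, hxy⟩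
    exact ⟨x, hx, congrArg Subtype.val hxy⟩
  · rintro ⟨x, hx, hxy⟩
    obtain ⟨x', hx', rfl⟩ := hy
    obtain rfl := hf hxy
    exact ⟨⟨x, hx'⟩, hx, rfl⟩

/-- If `L` is generated by one element modulo `N` and the maximal ideal multiplies that element
into `N`, then `L / N` is zero or simple. -/
theorem covBy_of_le_sup_span [IsLocalRing R] {L N : Submodule R M} {z : M} (hz : z ∈ L)
    (hzN : z ∉ N) (hNL : N ≤ L) (hm : ∀ a ∈ IsLocalRing.maximalIdeal R, a • z ∈ N)
    (h : L ≤ N ⊔ Submodule.span R {z}) : N ⋖ L := by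
  refine ⟨lt_of_le_of_ne hNL (by rintro rfl; exact hzN hz), fun P hNP hPL => hPL.not_ge ?_⟩
  obtain ⟨y, hyP, hyN⟩ := SetLike.exists_of_lt hNP
  obtain ⟨n, hn, w, hw, hnw⟩ := Submodule.mem_sup.mp (h (hPL.le hyP))
  obtain ⟨a, rfl⟩ := Submodule.mem_span_singleton.mp hw
  have ha : IsUnit a := by
    by_contra ha
    exact hyN (hnw ▸ N.add_mem hn (hm a ha))
  have haz : a • z ∈ P := by
    rw [← hnw] at hyP
    exact (P.add_mem_iff_right (hNP.le hn)).mp hyP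
  refine h.trans (sup_le hNP.le ?_)
  rw [Submodule.span_singleton_le_iff_mem]
  obtain ⟨u, rfl⟩ := ha
  have := P.smul_mem (↑u⁻¹ : R) haz
  rwa [smul_smul, Units.inv_mul, one_smul] at this

end Length

/-! ### Colon calculus and multiplication by nonzero scalars. -/

section Colon

variable {R K : Type*} [CommRing R] [Field K] [Algebra R K]

theorem div_div_eq (A B C : Submodule R K) : A / B / C = A / (B * C) := by
  refine eq_of_forall_le_iff fun D => ?_
  rw [Submodule.le_div_iff_mul_le, Submodule.le_div_iff_mul_le, Submodule.le_div_iff_mul_le,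
    mul_assoc, mul_comm C B]

theorem div_mono {A A' B B' : Submodule R K} (hA : A ≤ A') (hB : B' ≤ B) : A / B ≤ A' / B' := by
  rw [Submodule.le_div_iff] at *
  exact fun x hx z hz => hA (Submodule.le_div_iff.mp le_rfl x hx z (hB hz))

theorem div_mul_le (A B : Submodule R K) : A / B * B ≤ A :=
  Submodule.le_div_iff_mul_le.mp le_rfl

theorem le_div_div (A B : Submodule R K) : B ≤ A / (A / B) := by
  rw [Submodule.le_div_iff_mul_le, mul_comm]
  exact div_mul_le A B

theorem div_one_eq (A : Submodule R K) : A / 1 = A := by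
  refine eq_of_forall_le_iff fun D => ?_
  rw [Submodule.le_div_iff_mul_le, mul_one]

theorem span_mul_span_inv {d : K} (hd : d ≠ 0) :
    Submodule.span R {d} * Submodule.span R {d⁻¹} = 1 := by
  rw [Submodule.span_mul_span, Set.singleton_mul_singleton, mul_inv_cancel₀ hd,
    Submodule.one_eq_span]

theorem span_inv_mul_span {d : K} (hd : d ≠ 0) :
    Submodule.span R {d⁻¹} * Submodule.span R {d} = 1 := by
  rw [mul_comm, span_mul_span_inv hd]

theorem span_mul_cancel {d : K} (hd : d ≠ 0) (A : Submodule R K) :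
    Submodule.span R {d} * (Submodule.span R {d⁻¹} * A) = A := by
  rw [← mul_assoc, span_mul_span_inv hd, one_mul]

theorem span_inv_mul_cancel {d : K} (hd : d ≠ 0) (A : Submodule R K) :
    Submodule.span R {d⁻¹} * (Submodule.span R {d} * A) = A := by
  rw [← mul_assoc, span_inv_mul_span hd, one_mul]

theorem mul_le_mul_of_le {A A' B B' : Submodule R K} (hA : A ≤ A') (hB : B ≤ B') :
    A * B ≤ A' * B' :=
  Submodule.mul_le.mpr fun _ ha _ hb => Submodule.mul_mem_mul (hA ha) (hB hb)

theorem div_span_mul {d : K} (hd : d ≠ 0) (A B : Submodule R K) :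
    A / (Submodule.span R {d} * B) = Submodule.span R {d⁻¹} * (A / B) := by
  refine le_antisymm ?_ ?_
  · rw [← span_inv_mul_cancel hd (A / (Submodule.span R {d} * B))]
    refine mul_le_mul_of_le le_rfl ?_
    rw [Submodule.le_div_iff_mul_le, mul_comm (Submodule.span R {d}), mul_assoc]
    exact div_mul_le _ _
  · rw [Submodule.le_div_iff_mul_le, mul_mul_mul_comm, span_inv_mul_span hd, one_mul]
    exact div_mul_le _ _

theorem span_mul_div {d : K} (hd : d ≠ 0) (A B : Submodule R K) :
    (Submodule.span R {d} * A) / B = Submodule.span R {d} * (A / B) := by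
  refine le_antisymm ?_ ?_
  · rw [← span_mul_cancel hd ((Submodule.span R {d} * A) / B)]
    refine mul_le_mul_of_le le_rfl ?_
    rw [Submodule.le_div_iff_mul_le, mul_assoc]
    refine (mul_le_mul_of_le le_rfl (div_mul_le _ _)).trans ?_
    rw [span_inv_mul_cancel hd]
  · rw [Submodule.le_div_iff_mul_le, mul_assoc]
    exact mul_le_mul_of_le le_rfl (div_mul_le _ _)

theorem mem_span_mul {d z : K} {A : Submodule R K} :
    z ∈ Submodule.span R {d} * A ↔ ∃ a ∈ A, d * a = z := Submodule.mem_span_singleton_mul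

theorem len_span_mul {d : K} (hd : d ≠ 0) (A B : Submodule R K) :
    len (Submodule.span R {d} * A) (Submodule.span R {d} * B) = len A B := by
  have h : ∀ C : Submodule R K, Submodule.span R {d} * C = C.map (LinearMap.mulLeft R d) := by
    intro C
    ext z
    rw [mem_span_mul]
    rfl
  rw [h, h]
  exact len_map (fun x y h => mul_left_cancel₀ hd h) A B

/-- The length of `A / B` as a natural number. -/
noncomputable def lenNat (A B : Submodule R K) : ℕ := (len A B).toNat

theorem lenNat_self (A : Submodule R K) : lenNat A A = 0 := by rw [lenNat, len_self]; rfl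

theorem lenNat_span_mul {d : K} (hd : d ≠ 0) (A B : Submodule R K) :
    lenNat (Submodule.span R {d} * A) (Submodule.span R {d} * B) = lenNat A B := by
  rw [lenNat, len_span_mul hd, lenNat]

theorem span_mul_injective {d : K} (hd : d ≠ 0) {A B : Submodule R K}
    (h : Submodule.span R {d} * A = Submodule.span R {d} * B) : A = B := by
  rw [← span_inv_mul_cancel hd A, h, span_inv_mul_cancel hd]

theorem span_pow (d : K) (n : ℕ) : Submodule.span R {d} ^ n = Submodule.span R {d ^ n} := by
  rw [Submodule.span_pow, Set.singleton_pow]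

end Colon

/-! ### Fractional ideals and finiteness of lengths. -/

section Fractional

variable {R K : Type*} [CommRing R] [IsDomain R] [Field K] [Algebra R K] [IsFractionRing R K]

variable (R K) in
/-- Nonzero fractional ideals of `R`. -/
def IsFrac (J : Submodule R K) : Prop := J ≠ ⊥ ∧ IsFractional R⁰ J

theorem isFrac_iff {J : Submodule R K} :
    IsFrac R K J ↔ J ≠ ⊥ ∧ ∃ d : K, d ≠ 0 ∧ J ≤ Submodule.span R {d} := by
  refine and_congr_right fun _ => ⟨?_, ?_⟩
  · rintro ⟨a, ha, h⟩
    have ha' : algebraMap R K a ≠ 0 := IsFractionRing.to_map_ne_zero_of_mem_nonZeroDivisors ha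
    refine ⟨(algebraMap R K a)⁻¹, inv_ne_zero ha', fun b hb => ?_⟩
    obtain ⟨r, hr⟩ := h b hb
    refine Submodule.mem_span_singleton.mpr ⟨r, ?_⟩
    rw [Algebra.smul_def, hr, Algebra.smul_def]
    field_simp
  · rintro ⟨d, hd, h⟩
    obtain ⟨a, ha, h'⟩ := FractionalIdeal.isFractional_span_singleton (S := R⁰) d
    exact ⟨a, ha, fun b hb => h' b (h hb)⟩

theorem isFrac_span {d : K} (hd : d ≠ 0) : IsFrac R K (Submodule.span R {d}) :=
  isFrac_iff.mpr ⟨by simpa using hd, d, hd, le_rfl⟩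

theorem isFrac_one : IsFrac R K 1 := by
  rw [Submodule.one_eq_span]; exact isFrac_span one_ne_zero

theorem IsFrac.of_le {A B C : Submodule R K} (hA : IsFrac R K A) (hC : IsFrac R K C) (hAB : A ≤ B)
    (hBC : B ≤ C) : IsFrac R K B := by
  obtain ⟨_, d, hd, h⟩ := isFrac_iff.mp hC
  exact isFrac_iff.mpr ⟨fun h => hA.1 (le_bot_iff.mp (h ▸ hAB)), d, hd, hBC.trans h⟩

theorem IsFrac.exists_mem {A : Submodule R K} (hA : IsFrac R K A) :
    ∃ d : K, d ≠ 0 ∧ d ∈ A ∧ Submodule.span R {d} ≤ A := by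
  obtain ⟨d, hd, h⟩ := Submodule.exists_mem_ne_zero_of_ne_bot hA.1
  exact ⟨d, h, hd, by simpa using hd⟩

theorem IsFrac.mul {A B : Submodule R K} (hA : IsFrac R K A) (hB : IsFrac R K B) :
    IsFrac R K (A * B) :=
  ⟨by rw [Ne, Submodule.mul_eq_bot, not_or]; exact ⟨hA.1, hB.1⟩, hA.2.mul hB.2⟩

theorem IsFrac.div {A B : Submodule R K} (hA : IsFrac R K A) (hB : IsFrac R K B) :
    IsFrac R K (A / B) := by
  obtain ⟨a, ha, -, haA⟩ := hA.exists_mem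
  obtain ⟨b, hb, -, hbB⟩ := hB.exists_mem
  obtain ⟨_, a', ha', haA'⟩ := isFrac_iff.mp hA
  obtain ⟨_, b', hb', hbB'⟩ := isFrac_iff.mp hB
  have key : ∀ {d e : K}, e ≠ 0 →
      (Submodule.span R {d} : Submodule R K) / Submodule.span R {e} =
        Submodule.span R {e⁻¹ * d} := by
    intro d e he
    have := div_span_mul he (Submodule.span R {d}) 1
    rwa [mul_one, div_one_eq, Submodule.span_mul_span, Set.singleton_mul_singleton] at this
  refine IsFrac.of_le (A := Submodule.span R {b'⁻¹ * a}) (C := Submodule.span R {b⁻¹ * a'})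
    (isFrac_span (mul_ne_zero (inv_ne_zero hb') ha))
    (isFrac_span (mul_ne_zero (inv_ne_zero hb) ha')) ?_ ?_
  · rw [← key hb']; exact div_mono haA hbB'
  · rw [← key hb]; exact div_mono haA' hbB

theorem isFrac_inK {I : Ideal R} (hI : I ≠ ⊥) : IsFrac R K (inK K I) := by
  refine ⟨fun h => hI ?_, FractionalIdeal.isFractional_of_le_one _ ?_⟩
  · exact IsFractionRing.coeSubmodule_injective R K (h.trans (IsLocalization.coeSubmodule_bot K).symm)
  · rw [← IsLocalization.coeSubmodule_top]
    exact IsLocalization.coeSubmodule_mono _ le_top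

theorem len_inK (I J : Ideal R) : len (inK K I) (inK K J) = len I J :=
  len_map (f := Algebra.linearMap R K) (IsFractionRing.injective R K) I J

theorem inK_le_inK {I J : Ideal R} : inK K I ≤ inK K J ↔ I ≤ J :=
  IsFractionRing.coeSubmodule_le_coeSubmodule

theorem inK_top : inK K (⊤ : Ideal R) = 1 := IsLocalization.coeSubmodule_top K

theorem inK_le_one (I : Ideal R) : inK K I ≤ 1 := by
  rw [← inK_top]; exact inK_le_inK.mpr le_top

theorem inK_mul (I J : Ideal R) : inK K (I * J) = inK K I * inK K J :=
  IsLocalization.coeSubmodule_mul K I J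

theorem inK_pow (I : Ideal R) (n : ℕ) : inK K (I ^ n) = inK K I ^ n := by
  induction n with
  | zero => rw [pow_zero, pow_zero, Ideal.one_eq_top, inK_top]
  | succ n ih => rw [pow_succ, pow_succ, inK_mul, ih]

theorem inK_span (x : R) : inK K (Ideal.span {x}) = Submodule.span R {algebraMap R K x} :=
  IsLocalization.coeSubmodule_span_singleton K x

theorem mem_inK {I : Ideal R} {a : R} : algebraMap R K a ∈ inK K I ↔ a ∈ I := by
  rw [IsLocalization.mem_coeSubmodule]
  exact ⟨fun ⟨y, hy, h⟩ => IsFractionRing.injective R K h ▸ hy, fun h => ⟨a, h, rfl⟩⟩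

theorem IsFrac.inf {A B : Submodule R K} (hA : IsFrac R K A) (hB : IsFrac R K B) :
    IsFrac R K (A ⊓ B) := by
  refine isFrac_iff.mpr ⟨fun h => ?_, ?_⟩
  · obtain ⟨a, ha, haA, _⟩ := hA.exists_mem
    obtain ⟨b, hb, hbB, _⟩ := hB.exists_mem
    obtain ⟨p, q, hq, rfl⟩ := IsFractionRing.div_surjective (A := R) a
    obtain ⟨r, s, hs, rfl⟩ := IsFractionRing.div_surjective (A := R) b
    have hq' : algebraMap R K q ≠ 0 := IsFractionRing.to_map_ne_zero_of_mem_nonZeroDivisors hq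
    have hs' : algebraMap R K s ≠ 0 := IsFractionRing.to_map_ne_zero_of_mem_nonZeroDivisors hs
    -- With `a = p/q` and `b = r/s`, one has `pr = (qr)a = (sp)b`.
    have hmem : algebraMap R K p * algebraMap R K r ∈ A ⊓ B := by
      rw [Submodule.mem_inf]
      constructor
      · have := A.smul_mem (q * r) haA
        rw [Algebra.smul_def, map_mul] at this
        convert this using 1
        field_simp
      · have := B.smul_mem (s * p) hbB
        rw [Algebra.smul_def, map_mul] at this
        convert this using 1
        field_simp
    rw [h, Submodule.mem_bot] at hmem
    rcases mul_eq_zero.mp hmem with h | h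
    · exact ha (by rw [h, zero_div])
    · exact hb (by rw [h, zero_div])
  · obtain ⟨_, d, hd, h⟩ := isFrac_iff.mp hA
    exact ⟨d, hd, inf_le_left.trans h⟩

variable [IsNoetherianRing R] [Ring.KrullDimLE 1 R]

theorem len_one_span_ne_top {a : R} (ha : a ≠ 0) :
    len (1 : Submodule R K) (Submodule.span R {algebraMap R K a}) ≠ ⊤ := by
  rw [← inK_top, ← inK_span, len_inK, len, Module.length_ne_top_iff]
  refine (isFiniteLength_quotient_span_singleton R (mem_nonZeroDivisors_of_ne_zero ha)).of_injective
    (f := Submodule.mapQ _ _ (⊤ : Ideal R).subtype le_rfl) ?_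
  rw [← LinearMap.ker_eq_bot]
  exact Submodule.ker_liftQ_eq_bot _ _ _ (by
    intro x hx
    simpa [Submodule.submoduleOf, Ideal.Quotient.eq_zero_iff_mem] using hx)

/-- If `A ⊆ dR` and `0 ≠ b = rd ∈ B`, the length is at most `ℓ(dR/bR) = ℓ(R/rR)`, finite in
dimension one. This makes `lenNat` faithful, although `toNat` sends `⊤` to `0`. -/
theorem IsFrac.len_ne_top {A B : Submodule R K} (hA : IsFrac R K A) (hB : IsFrac R K B)
    (h : B ≤ A) : len A B ≠ ⊤ := by
  obtain ⟨_, d, hd, hAd⟩ := isFrac_iff.mp hA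
  obtain ⟨b, hb, hbB, hbB'⟩ := hB.exists_mem
  refine ne_top_of_le_ne_top ?_ (len_mono hbB' h hAd)
  obtain ⟨r, hr⟩ := Submodule.mem_span_singleton.mp (hAd (h hbB))
  have hr0 : r ≠ 0 := by rintro rfl; exact hb (by rw [← hr, zero_smul])
  have h1 : (Submodule.span R {d} : Submodule R K) = Submodule.span R {d} * 1 := (mul_one _).symm
  have h2 : (Submodule.span R {b} : Submodule R K) =
      Submodule.span R {d} * Submodule.span R {algebraMap R K r} := by
    rw [Submodule.span_mul_span, Set.singleton_mul_singleton, ← hr, Algebra.smul_def, mul_comm]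
  rw [h1, h2, len_span_mul hd]
  exact len_one_span_ne_top hr0

theorem IsFrac.coe_lenNat {A B : Submodule R K} (hA : IsFrac R K A) (hB : IsFrac R K B)
    (h : B ≤ A) : (lenNat A B : ℕ∞) = len A B := ENat.natCast_toNat (hA.len_ne_top hB h)

theorem lenNat_add {A B C : Submodule R K} (hA : IsFrac R K A) (hC : IsFrac R K C) (hCB : C ≤ B)
    (hBA : B ≤ A) : lenNat A C = lenNat B C + lenNat A B := by
  have hB := hC.of_le hA hCB hBA
  have := len_add hCB hBA
  rw [← hA.coe_lenNat hC (hCB.trans hBA), ← hA.coe_lenNat hB hBA, ← hB.coe_lenNat hC hCB] at this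
  exact_mod_cast this

theorem eq_of_lenNat_eq_zero {A B : Submodule R K} (hA : IsFrac R K A) (hB : IsFrac R K B)
    (h : B ≤ A) (h0 : lenNat A B = 0) : A = B := by
  refine le_antisymm (le_of_len_eq_zero ?_) h
  rw [← hA.coe_lenNat hB h, h0]; rfl

/-- The length of `A / dA` does not depend on the fractional ideal `A`. -/
theorem lenNat_self_span_mul {d : K} (hd : d ≠ 0) {A B : Submodule R K} (hA : IsFrac R K A)
    (hB : IsFrac R K B) (hdA : Submodule.span R {d} * A ≤ A) (hdB : Submodule.span R {d} * B ≤ B)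
    (h : B ≤ A) : lenNat A (Submodule.span R {d} * A) = lenNat B (Submodule.span R {d} * B) := by
  have hdB' := (isFrac_span (R := R) hd).mul hB
  have h1 := lenNat_add hA hdB' (mul_le_mul_of_le le_rfl h) hdA
  have h2 := lenNat_add hA hdB' hdB h
  rw [lenNat_span_mul hd] at h1
  omega

theorem lenNat_span_pow_mul {d : K} (hd : d ≠ 0) {A : Submodule R K} (hA : IsFrac R K A)
    (hdA : Submodule.span R {d} * A ≤ A) (n : ℕ) :
    Submodule.span R {d ^ n} * A ≤ A ∧
    lenNat A (Submodule.span R {d ^ n} * A) = n * lenNat A (Submodule.span R {d} * A) := by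
  induction n with
  | zero =>
    rw [pow_zero, ← Submodule.one_eq_span, one_mul, zero_mul, lenNat_self]
    exact ⟨le_rfl, rfl⟩
  | succ n ih =>
    have h : Submodule.span R {d ^ (n + 1)} * A =
        Submodule.span R {d ^ n} * (Submodule.span R {d} * A) := by
      rw [← mul_assoc, Submodule.span_mul_span, Set.singleton_mul_singleton, pow_succ]
    have hle : Submodule.span R {d ^ (n + 1)} * A ≤ Submodule.span R {d ^ n} * A := by
      rw [h]; exact mul_le_mul_of_le le_rfl hdA
    refine ⟨hle.trans ih.1, ?_⟩
    rw [lenNat_add hA ((isFrac_span (pow_ne_zero _ hd)).mul hA) hle ih.1, ih.2, h,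
      lenNat_span_mul (pow_ne_zero _ hd)]
    ring

end Fractional

/-! ### Duality with respect to a canonical ideal. -/

section Duality

variable {R K : Type*} [CommRing R] [IsDomain R] [Field K] [Algebra R K] [IsFractionRing R K]
  {W : Submodule R K}

theorem IsCanonicalIdeal.isFrac (hW : IsCanonicalIdeal R K W) : IsFrac R K W := ⟨hW.1, hW.2.1⟩

theorem IsCanonicalIdeal.div_div (hW : IsCanonicalIdeal R K W) {J : Submodule R K}
    (hJ : IsFrac R K J) : W / (W / J) = J := hW.2.2 J hJ.1 hJ.2

theorem IsCanonicalIdeal.div_self (hW : IsCanonicalIdeal R K W) : W / W = 1 := by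
  simpa [div_one_eq] using hW.div_div isFrac_one

/-- `J ↦ W : J` reverses inclusions and preserves lengths. -/
theorem IsCanonicalIdeal.len_div (hW : IsCanonicalIdeal R K W) {A B : Submodule R K}
    (hA : IsFrac R K A) (hB : IsFrac R K B) (h : B ≤ A) : len (W / B) (W / A) = len A B := by
  refine (len_eq_of_orderIso_dual h (div_mono le_rfl h)
    { toFun := fun J => OrderDual.toDual
        ⟨W / J.1, div_mono le_rfl J.2.2, div_mono le_rfl J.2.1⟩
      invFun := fun J => ⟨W / (OrderDual.ofDual J).1,
        (le_div_div W B).trans (div_mono le_rfl (OrderDual.ofDual J).2.2),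
        (div_mono le_rfl (OrderDual.ofDual J).2.1).trans (hW.div_div hA).le⟩
      left_inv := fun J => Subtype.ext (hW.div_div (hB.of_le hA J.2.1 J.2.2))
      right_inv := fun J => Subtype.ext (hW.div_div ((hW.isFrac.div hA).of_le (hW.isFrac.div hB)
        (OrderDual.ofDual J).2.1 (OrderDual.ofDual J).2.2))
      map_rel_iff' := fun {J J'} => by
        change W / J'.1 ≤ W / J.1 ↔ J.1 ≤ J'.1
        refine ⟨fun h' => ?_, fun h' => div_mono le_rfl h'⟩
        rw [← hW.div_div (hB.of_le hA J.2.1 J.2.2), ← hW.div_div (hB.of_le hA J'.2.1 J'.2.2)]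
        exact div_mono le_rfl h' }).symm

theorem IsCanonicalIdeal.lenNat_div (hW : IsCanonicalIdeal R K W) {A B : Submodule R K}
    (hA : IsFrac R K A) (hB : IsFrac R K B) (h : B ≤ A) :
    lenNat (W / B) (W / A) = lenNat A B := by
  rw [lenNat, hW.len_div hA hB h, lenNat]

end Duality

end CurveBlowup

namespace CurveBlowup

/-! ### The normalization and the conductor. -/

section Normalization

variable {R : Type*} [CommRing R] [IsDomain R] {K : Type*} [Field K] [Algebra R K]
  [IsFractionRing R K]

/-- Multiplying a monic equation of degree `k + 1` for `u⁻¹` by `u^k` expresses `u⁻¹` as a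
polynomial in `u`. So an element of an overring `A ⊆ R̄` that is a unit of `R̄` is already a unit of
`A`. -/
theorem inv_mem_of_mem_normalization (A : Subalgebra R K) {u : K} (hu : u ∈ A)
    (h : u⁻¹ ∈ normalization R K) : u⁻¹ ∈ A := by
  rcases eq_or_ne u 0 with rfl | hu0
  · simp
  obtain ⟨p, hp, hpw⟩ : IsIntegral R u⁻¹ := h
  rw [Polynomial.eval₂_eq_sum_range, Finset.sum_range_succ, hp.coeff_natDegree, map_one,
    one_mul] at hpw
  rcases Nat.eq_zero_or_eq_succ_pred p.natDegree with hn | hn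
  · rw [hn] at hpw
    simp at hpw
  rw [hn] at hpw
  set k := p.natDegree.pred
  have hw : u⁻¹ = -∑ i ∈ Finset.range (k + 1), algebraMap R K (p.coeff i) * u ^ (k - i) := by
    rw [← Finset.sum_neg_distrib, ← sub_eq_zero, Finset.sum_neg_distrib, sub_neg_eq_add,
      add_comm, ← mul_zero (u ^ k), ← hpw, mul_add, Finset.mul_sum]
    congr 1
    · refine Finset.sum_congr rfl fun i hi => ?_
      have hik : i ≤ k := Nat.lt_succ_iff.mp (Finset.mem_range.mp hi)
      rw [pow_sub₀ u hu0 hik, inv_pow]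
      ring
    · rw [pow_succ, ← mul_assoc, ← mul_pow, mul_inv_cancel₀ hu0, one_pow, one_mul]
  rw [hw]
  exact A.neg_mem (A.sum_mem fun i _ => A.mul_mem (A.algebraMap_mem _) (A.pow_mem hu _))

theorem one_le_normalization : 1 ≤ normalization R K := by
  rw [Submodule.one_le]; exact (integralClosure R K).one_mem

theorem one_le_toSubmodule (A : Subalgebra R K) : 1 ≤ Subalgebra.toSubmodule A := by
  rw [Submodule.one_le]; exact A.one_mem

theorem toSubmodule_mul_self (A : Subalgebra R K) :
    Subalgebra.toSubmodule A * Subalgebra.toSubmodule A = Subalgebra.toSubmodule A :=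
  le_antisymm (Submodule.mul_le.mpr fun _ ha _ hb => A.mul_mem ha hb)
    fun a ha => by
      simpa using Submodule.mul_mem_mul ha (show (1 : K) ∈ Subalgebra.toSubmodule A from A.one_mem)

theorem normalization_mul_self :
    normalization R K * normalization R K = normalization R K :=
  toSubmodule_mul_self _

theorem isFrac_normalization [Module.Finite R (integralClosure R K)] :
    IsFrac R K (normalization R K) := by
  refine ⟨fun h => ?_, FractionalIdeal.isFractional_of_fg ?_⟩
  · have : (1 : K) ∈ normalization R K := (integralClosure R K).one_mem
    rw [h, Submodule.mem_bot] at this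
    exact one_ne_zero this
  · exact Module.Finite.iff_fg.mp ‹_›

theorem conductorIdeal_le_one : conductorIdeal R K ≤ 1 := by
  have := div_mono (le_refl (1 : Submodule R K)) (one_le_normalization (R := R) (K := K))
  rwa [div_one_eq] at this

theorem conductorIdeal_mul_normalization :
    conductorIdeal R K * normalization R K = conductorIdeal R K := by
  refine le_antisymm ?_ ?_
  · rw [conductorIdeal, Submodule.le_div_iff_mul_le, mul_assoc, normalization_mul_self]
    exact div_mul_le _ _
  · simpa using mul_le_mul_of_le (le_refl (conductorIdeal R K))
      (one_le_normalization (R := R) (K := K))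

variable [Module.Finite R (integralClosure R K)]

theorem isFrac_conductorIdeal : IsFrac R K (conductorIdeal R K) :=
  isFrac_one.div isFrac_normalization

variable [IsDiscreteValuationRing (integralClosure R K)]

/-- Every nonzero `R̄`-submodule of `R̄` is principal. -/
theorem exists_eq_span_mul_normalization {J : Submodule R K} (hJ : J ≠ ⊥)
    (hle : J ≤ normalization R K) (hmul : J * normalization R K ≤ J) :
    ∃ g : integralClosure R K, g ≠ 0 ∧ J = Submodule.span R {(g : K)} * normalization R K := by
  let a : Ideal (integralClosure R K) :=
    { carrier := {y | (y : K) ∈ J}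
      zero_mem' := J.zero_mem
      add_mem' := fun ha hb => J.add_mem ha hb
      smul_mem' := fun c y hy => by
        have := hmul (Submodule.mul_mem_mul hy c.2)
        rwa [mul_comm] at this }
  obtain ⟨g, hg⟩ := (IsPrincipalIdealRing.principal a).principal
  have hmem : ∀ y : integralClosure R K, (y : K) ∈ J ↔ g ∣ y := fun y => by
    rw [← Ideal.mem_span_singleton, ← Ideal.submodule_span_eq, ← hg]; rfl
  have heq : J = Submodule.span R {(g : K)} * normalization R K := by
    ext z
    rw [mem_span_mul]
    constructor
    · intro hz
      obtain ⟨w, hw⟩ := (hmem ⟨z, hle hz⟩).mp hz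
      exact ⟨w, w.2, (congrArg Subtype.val hw).symm⟩
    · rintro ⟨w, hw, rfl⟩
      exact (hmem (g * ⟨w, hw⟩)).mpr (dvd_mul_right _ _)
  refine ⟨g, ?_, heq⟩
  rintro rfl
  exact hJ (by rw [heq]; simp)

variable (R K) in
theorem exists_conductorIdeal_eq :
    ∃ g : integralClosure R K, g ≠ 0 ∧
      conductorIdeal R K = Submodule.span R {(g : K)} * normalization R K :=
  exists_eq_span_mul_normalization isFrac_conductorIdeal.1
    (conductorIdeal_le_one.trans one_le_normalization) conductorIdeal_mul_normalization.le

/-- Since `γ = gR̄`, one gets `R : γ = g⁻¹(R : R̄) = g⁻¹γ = R̄`. -/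
theorem one_div_conductorIdeal : 1 / conductorIdeal R K = normalization R K := by
  obtain ⟨g, hg, h⟩ := exists_conductorIdeal_eq R K
  have hg' : (g : K) ≠ 0 := by simpa using hg
  rw [h, div_span_mul hg', ← conductorIdeal, h, span_inv_mul_cancel hg']

end Normalization

/-! ### The value semigroup and the type sequence. -/

section TypeSequence

variable {R : Type*} [CommRing R] [IsDomain R] {K : Type*} [Field K] [Algebra R K]
  [IsFractionRing R K] [Module.Finite R (integralClosure R K)]
  [IsDiscreteValuationRing (integralClosure R K)]

open IsDiscreteValuationRing

theorem mem_conductorIdeal_iff_dvd {g : integralClosure R K}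
    (h : conductorIdeal R K = Submodule.span R {(g : K)} * normalization R K)
    (y : integralClosure R K) : (y : K) ∈ conductorIdeal R K ↔ g ∣ y := by
  rw [h, mem_span_mul]
  constructor
  · rintro ⟨w, hw, hgw⟩
    exact ⟨⟨w, hw⟩, Subtype.ext hgw.symm⟩
  · rintro ⟨w, rfl⟩
    exact ⟨w, w.2, rfl⟩

theorem exists_algebraMap_eq {y : integralClosure R K} (h : (y : K) ∈ conductorIdeal R K) :
    ∃ a : R, algebraMap R (integralClosure R K) a = y := by
  obtain ⟨a, ha⟩ := Submodule.mem_one.mp (conductorIdeal_le_one h)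
  exact ⟨a, Subtype.ext ha⟩

variable (R K) in
-- The conductor contains `g t^(b+1)` for every `b`. Infinitude matters because `Nat.nth` takes the
-- default value `0` beyond the end of a finite set.
theorem valueSemigroup_infinite : (Set.ofPred (· ∈ valueSemigroup R K)).Infinite := by
  obtain ⟨g, hg, h⟩ := exists_conductorIdeal_eq R K
  obtain ⟨t, ht⟩ := exists_irreducible (integralClosure R K)
  obtain ⟨c, hc⟩ := ENat.ne_top_iff_exists.mp (addVal_eq_top_iff.not.mpr hg)
  refine Set.infinite_of_not_bddAbove ?_
  rintro ⟨b, hb⟩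
  have hmem : c + (b + 1) ∈ Set.ofPred (· ∈ valueSemigroup R K) := by
    obtain ⟨a, ha⟩ := exists_algebraMap_eq
      ((mem_conductorIdeal_iff_dvd h (g * t ^ (b + 1))).mpr (dvd_mul_right _ _))
    refine ⟨a, ?_⟩
    rw [val, ha, addVal_mul, ht.addVal_pow, ← hc]
    simp
  have := hb hmem
  omega

theorem semigroupElt_mem (i : ℕ) : ∃ a : R, val R K a = semigroupElt R K i :=
  Nat.nth_mem_of_infinite (valueSemigroup_infinite R K) i

theorem mem_valIdeal {i : ℕ} {a : R} :
    a ∈ valIdeal R K i ↔ (semigroupElt R K i : ℕ∞) ≤ val R K a := Iff.rfl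

theorem semigroupElt_zero : semigroupElt R K 0 = 0 :=
  Nat.nth_zero_of_zero ⟨1, by simp [val]⟩

theorem valIdeal_zero : valIdeal R K 0 = ⊤ := by
  refine eq_top_iff.mpr fun a _ => ?_
  rw [mem_valIdeal, semigroupElt_zero]
  simp

theorem mem_valIdeal_succ {i : ℕ} {a : R} :
    a ∈ valIdeal R K (i + 1) ↔ (semigroupElt R K i : ℕ∞) < val R K a := by
  rw [mem_valIdeal]
  constructor
  · intro h
    refine lt_of_lt_of_le ?_ h
    exact_mod_cast (Nat.nth_lt_nth (valueSemigroup_infinite R K)).mpr (Nat.lt_succ_self i)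
  · intro h
    by_cases htop : val R K a = ⊤
    · rw [htop]; exact le_top
    · obtain ⟨n, hn⟩ := ENat.ne_top_iff_exists.mp htop
      rw [← hn] at h ⊢
      by_contra hlt
      have h1 : n ≤ semigroupElt R K i :=
        Nat.le_nth_of_lt_nth_succ (by exact_mod_cast not_le.mp hlt) ⟨a, hn.symm⟩
      exact absurd h (not_lt.mpr (by exact_mod_cast h1))

theorem valIdeal_succ_le (i : ℕ) : valIdeal R K (i + 1) ≤ valIdeal R K i :=
  fun _ ha => mem_valIdeal.mpr (mem_valIdeal_succ.mp ha).le

theorem not_isUnit_algebraMap [IsLocalRing R] {a : R} (ha : a ∈ IsLocalRing.maximalIdeal R) :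
    ¬ IsUnit (algebraMap R (integralClosure R K) a) := by
  rintro ⟨u, hu⟩
  refine (IsLocalRing.mem_maximalIdeal a).mp ha ?_
  have hu' : algebraMap R K a * ((u⁻¹ : (integralClosure R K)ˣ) : integralClosure R K) = 1 := by
    have := congrArg Subtype.val u.mul_inv
    rw [hu] at this
    exact this
  have hinv := eq_inv_of_mul_eq_one_right hu'
  have hmem := inv_mem_of_mem_normalization (⊥ : Subalgebra R K)
    (u := algebraMap R K a) (Subalgebra.algebraMap_mem _ a) (by rw [← hinv]; exact Subtype.prop _)
  obtain ⟨r, hr⟩ := Algebra.mem_bot.mp hmem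
  refine IsUnit.of_mul_eq_one r (IsFractionRing.injective R K ?_)
  rw [map_mul, hr, map_one]
  rw [← hinv, hu']

variable [IsLocalRing R]

theorem exists_not_isUnit_sub_algebraMap
    (hres : Function.Surjective ((IsLocalRing.residue (integralClosure R K)).comp
      (algebraMap R (integralClosure R K)))) (y : integralClosure R K) :
    ∃ r : R, ¬ IsUnit (y - algebraMap R (integralClosure R K) r) := by
  obtain ⟨r, hr⟩ := hres (IsLocalRing.residue _ y)
  refine ⟨r, ?_⟩
  rw [← mem_nonunits_iff, ← IsLocalRing.mem_maximalIdeal, ← IsLocalRing.residue_eq_zero_iff,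
    map_sub, sub_eq_zero]
  exact hr.symm

/-- Let `v(b) = s_i`. Any `a` in the ideal is `yb` with `y ∈ R̄`, and `y` is congruent to some `r ∈
R` modulo `t` because the residue fields agree; then `a - rb` has larger value. So `b` generates
`R_i` modulo `R_(i+1)`. -/
theorem valIdeal_succ_covBy
    (hres : Function.Surjective ((IsLocalRing.residue (integralClosure R K)).comp
      (algebraMap R (integralClosure R K)))) (i : ℕ) :
    valIdeal R K (i + 1) ⋖ valIdeal R K i := by
  obtain ⟨b, hb⟩ := semigroupElt_mem (R := R) (K := K) i
  have hpos : ∀ y : integralClosure R K, ¬ IsUnit y →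
      (semigroupElt R K i : ℕ∞) < addVal _ (y * algebraMap R _ b) := by
    intro y hy
    rw [addVal_mul]
    have h1 : addVal _ (algebraMap R (integralClosure R K) b) = semigroupElt R K i := hb
    rw [h1]
    have h2 : addVal _ y ≠ 0 := fun h => hy (addVal_eq_zero_iff.mp h)
    calc (semigroupElt R K i : ℕ∞) < 1 + semigroupElt R K i := by
          rw [add_comm]; exact_mod_cast Nat.lt_succ_self _
      _ ≤ _ := by gcongr; exact Order.one_le_iff_pos.mpr (pos_iff_ne_zero.mpr h2)
  refine covBy_of_le_sup_span (z := b) (mem_valIdeal.mpr hb.ge)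
    (fun h => absurd (mem_valIdeal_succ.mp h) (by rw [hb]; exact lt_irrefl _))
    (valIdeal_succ_le i) (fun a ha => ?_) (fun a ha => ?_)
  · rw [mem_valIdeal_succ, val, smul_eq_mul, map_mul]
    exact hpos _ (not_isUnit_algebraMap ha)
  · obtain ⟨y, hy⟩ := addVal_le_iff_dvd.mp (hb.le.trans (mem_valIdeal.mp ha))
    obtain ⟨r, hr⟩ := exists_not_isUnit_sub_algebraMap hres y
    refine Submodule.mem_sup.mpr ⟨a - r * b, ?_, r • b, Submodule.mem_span_singleton.mpr ⟨r, rfl⟩,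
      by rw [smul_eq_mul]; ring⟩
    rw [mem_valIdeal_succ, val]
    have : algebraMap R (integralClosure R K) (a - r * b) =
        (y - algebraMap R _ r) * algebraMap R _ b := by
      rw [map_sub, map_mul, hy]; ring
    rw [this]
    exact hpos _ hr

theorem valIdeal_one
    (hres : Function.Surjective ((IsLocalRing.residue (integralClosure R K)).comp
      (algebraMap R (integralClosure R K)))) :
    valIdeal R K 1 = IsLocalRing.maximalIdeal R := by
  have h := valIdeal_succ_covBy hres 0
  rw [valIdeal_zero, covBy_top_iff] at h
  exact IsLocalRing.eq_maximalIdeal ⟨h⟩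

theorem len_one_valIdeal
    (hres : Function.Surjective ((IsLocalRing.residue (integralClosure R K)).comp
      (algebraMap R (integralClosure R K)))) (i : ℕ) :
    len (1 : Submodule R K) (inK K (valIdeal R K i)) = i := by
  rw [← inK_top, len_inK]
  induction i with
  | zero => rw [valIdeal_zero, len_self]; rfl
  | succ i ih =>
    rw [len_add (valIdeal_succ_le i) le_top, ih,
      len_eq_one_of_covBy (valIdeal_succ_covBy hres i), add_comm]
    rfl

variable (R K) in
theorem exists_inK_valIdeal_eq_conductorIdeal :
    ∃ n, inK K (valIdeal R K n) = conductorIdeal R K := by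
  classical
  obtain ⟨g, hg, h⟩ := exists_conductorIdeal_eq R K
  obtain ⟨c, hc⟩ := ENat.ne_top_iff_exists.mp (addVal_eq_top_iff.not.mpr hg)
  have hcS : c ∈ valueSemigroup R K := by
    obtain ⟨a, ha⟩ := exists_algebraMap_eq ((mem_conductorIdeal_iff_dvd h g).mpr dvd_rfl)
    exact ⟨a, by rw [val, ha, hc]⟩
  -- `γ` consists of the elements of value at least `c = v(g)`, and `c` lies in the semigroup; its
  -- index is the number of semigroup elements below it.
  refine ⟨Nat.count (· ∈ valueSemigroup R K) c, ?_⟩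
  have hsc : semigroupElt R K (Nat.count (· ∈ valueSemigroup R K) c) = c :=
    Nat.nth_count (p := (· ∈ valueSemigroup R K)) hcS
  have hiff : ∀ a : R, a ∈ valIdeal R K (Nat.count (· ∈ valueSemigroup R K) c) ↔
      algebraMap R K a ∈ conductorIdeal R K := by
    intro a
    rw [mem_valIdeal, hsc, hc, val, addVal_le_iff_dvd, ← mem_conductorIdeal_iff_dvd h]
    rfl
  ext z
  constructor
  · intro hz
    obtain ⟨a, ha, rfl⟩ := (IsLocalization.mem_coeSubmodule K _).mp hz
    exact (hiff a).mp ha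
  · intro hz
    obtain ⟨a, rfl⟩ := Submodule.mem_one.mp (conductorIdeal_le_one hz)
    exact mem_inK.mpr ((hiff a).mpr hz)

theorem cmType_eq
    (hres : Function.Surjective ((IsLocalRing.residue (integralClosure R K)).comp
      (algebraMap R (integralClosure R K)))) :
    cmType R K = len (1 / inK K (IsLocalRing.maximalIdeal R)) 1 := by
  rw [cmType, typeSeq, valIdeal_one hres, Nat.sub_self, valIdeal_zero, inK_top, div_one_eq]

/-- For an almost Gorenstein ring `ℓ(R̄ / R) = ℓ(R / γ) + r - 1`. -/
theorem IsAlmostGorenstein.len_normalization (hAG : IsAlmostGorenstein R K)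
    (hres : Function.Surjective ((IsLocalRing.residue (integralClosure R K)).comp
      (algebraMap R (integralClosure R K)))) (hne : conductorIdeal R K ≠ 1) :
    len (normalization R K) 1 + 1 = cmType R K + len 1 (conductorIdeal R K) := by
  obtain ⟨n, hn⟩ := exists_inK_valIdeal_eq_conductorIdeal R K
  have hlen : len 1 (conductorIdeal R K) = n := by rw [← hn, len_one_valIdeal hres]
  obtain ⟨m, rfl⟩ : ∃ m, n = m + 1 := by
    refine Nat.exists_eq_succ_of_ne_zero ?_
    rintro rfl
    rw [valIdeal_zero, inK_top] at hn
    exact hne hn.symm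
  -- The chain `R ⊆ R : R_1 ⊆ R : R_2 ⊆ ⋯` ends at `R : γ = R̄`; its first step contributes `r`,
  -- every later one `1`.
  have key : ∀ k ≤ m, len (1 / inK K (valIdeal R K (k + 1))) 1 = cmType R K + k := by
    intro k
    induction k with
    | zero => intro _; rw [valIdeal_one hres, cmType_eq hres]; simp
    | succ k ih =>
      intro hk
      have h1 : (1 : Submodule R K) ≤ 1 / inK K (valIdeal R K (k + 1)) :=
        Submodule.one_le_one_div.mpr (inK_le_one _)
      rw [len_add h1 (div_mono le_rfl (inK_le_inK.mpr (valIdeal_succ_le (k + 1)))),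
        ih (by omega)]
      have h2 := hAG (k + 1 + 1) (by omega) (by rw [hlen]; exact_mod_cast (by omega))
      rw [typeSeq, Nat.add_sub_cancel] at h2
      rw [h2, add_assoc]
      rfl
  have := key m le_rfl
  rw [hn, one_div_conductorIdeal] at this
  rw [this, hlen, add_assoc]
  rfl

end TypeSequence

end CurveBlowup

namespace CurveBlowup

/-! ### Simple socle of `K / W` and colengths. -/

section Socle

variable {R : Type*} [CommRing R] [IsDomain R] [IsLocalRing R] {K : Type*} [Field K] [Algebra R K]
  [IsFractionRing R K]

theorem exists_le_covBy {M : Type*} [AddCommGroup M] [Module R M] {A B : Submodule R M}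
    (h : B < A) (hfin : len A B ≠ ⊤) : ∃ C, B ≤ C ∧ C ⋖ A := by
  have := (isFiniteLength_iff_isNoetherian_isArtinian.mp (Module.length_ne_top_iff.mp hfin)).1
  have e := quotientOrderIsoIcc h.le
  have : Nontrivial (Set.Icc B A) :=
    ⟨⟨B, le_rfl, h.le⟩, ⟨A, h.le, le_rfl⟩, fun h' => h.ne (congrArg Subtype.val h')⟩
  have : Nontrivial (Submodule R (A ⧸ B.submoduleOf A)) := e.toEquiv.nontrivial
  obtain ⟨P, hP⟩ := IsCoatomic.exists_coatom (Submodule R (A ⧸ B.submoduleOf A))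
  have h1 : e P ⋖ e ⊤ := (apply_covBy_apply_iff e).mpr hP.covBy_top
  have h2 : e ⊤ = ⟨A, h.le, le_rfl⟩ := by
    refine le_antisymm (e ⊤).2.2 ?_
    rw [← e.symm_apply_le]
    exact le_top
  rw [h2] at h1
  refine ⟨(e P).1, (e P).2.1, h1.lt, fun Q hQ hQA => ?_⟩
  exact h1.2 (c := ⟨Q, (e P).2.1.trans hQ.le, hQA.le⟩) hQ hQA

/-- If the socle of `K / W` is generated by the class of `p`, colons into `W` take covering pairs to
pairs of colength at most one. -/
theorem len_div_le_one {W : Submodule R K} {p : K}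
    (hsoc : ∀ z : K, (∀ a ∈ IsLocalRing.maximalIdeal R, a • z ∈ W) → z ∈ W ⊔ Submodule.span R {p})
    (hmp : ∀ a ∈ IsLocalRing.maximalIdeal R, a • p ∈ W)
    {A B : Submodule R K} (h : B ⋖ A) : len (W / B) (W / A) ≤ 1 := by
  by_cases hle : W / B ≤ W / A
  · rw [le_antisymm hle (div_mono le_rfl h.le), len_self]
    exact zero_le_one
  obtain ⟨z₀, hz₀, hz₀A⟩ := SetLike.not_le_iff_exists.mp hle
  obtain ⟨y, hy, hyB⟩ := SetLike.exists_of_lt h.lt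
  have hsup : ∀ w ∈ A, w ∉ B → A = B ⊔ Submodule.span R {w} := fun w hw hwB => by
    refine ((h.eq_or_eq le_sup_left (sup_le h.le (by simpa using hw))).resolve_left ?_).symm
    intro heq
    exact hwB (heq ▸ Submodule.mem_sup_right (Submodule.mem_span_singleton_self w))
  -- Nakayama: if `ay ∉ B`, then `y ∈ B + Ray`, and `1 - ra` being a unit forces `y ∈ B`.
  have hmy : ∀ a ∈ IsLocalRing.maximalIdeal R, a • y ∈ B := by
    intro a ha
    by_contra hay
    have hy' := hy
    rw [hsup _ (A.smul_mem a hy) hay] at hy'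
    obtain ⟨b, hb, w, hw, hbw⟩ := Submodule.mem_sup.mp hy'
    obtain ⟨r, rfl⟩ := Submodule.mem_span_singleton.mp hw
    have hu : IsUnit (1 - r * a) :=
      (IsLocalRing.isUnit_one_sub_self_of_mem_nonunits _ (Ideal.mul_mem_left _ r ha))
    obtain ⟨u, hu⟩ := hu
    have hb' : (u : R) • y = b := by
      rw [hu, sub_smul, one_smul, mul_smul, sub_eq_iff_eq_add, hbw]
    have := B.smul_mem (↑u⁻¹ : R) hb
    rw [← hb', smul_smul, Units.inv_mul, one_smul] at this
    exact hyB this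
  have hcrit : ∀ z ∈ W / B, z * y ∈ W → z ∈ W / A := by
    intro z hz hzy
    rw [Submodule.mem_div_iff_forall_mul_mem] at hz ⊢
    intro w hw
    rw [hsup y hy hyB] at hw
    obtain ⟨b, hb, c, hc, rfl⟩ := Submodule.mem_sup.mp hw
    obtain ⟨r, rfl⟩ := Submodule.mem_span_singleton.mp hc
    rw [mul_add, mul_smul_comm]
    exact W.add_mem (hz b hb) (W.smul_mem r hzy)
  -- The class of `zy` lies in the socle of `K/W`. By `hcrit`, it vanishes only for `z ∈ W : A`, so
  -- `(W : B)/(W : A)` embeds in the line spanned by `p`.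
  have hzy : ∀ z ∈ W / B, ∃ r : R, z * y - r • p ∈ W := by
    intro z hz
    have := hsoc (z * y) fun a ha => by
      rw [← mul_smul_comm]
      exact (Submodule.mem_div_iff_forall_mul_mem.mp hz) _ (hmy a ha)
    obtain ⟨w, hw, c, hc, hwc⟩ := Submodule.mem_sup.mp this
    obtain ⟨r, rfl⟩ := Submodule.mem_span_singleton.mp hc
    exact ⟨r, by rwa [← hwc, add_sub_cancel_right]⟩
  obtain ⟨r₀, hr₀⟩ := hzy z₀ hz₀
  have hr₀u : IsUnit r₀ := by
    by_contra hr
    refine hz₀A (hcrit z₀ hz₀ ?_)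
    have := W.add_mem hr₀ (hmp r₀ hr)
    rwa [sub_add_cancel] at this
  obtain ⟨u, rfl⟩ := hr₀u
  refine (len_eq_one_of_covBy (covBy_of_le_sup_span hz₀ hz₀A (div_mono le_rfl h.le) ?_ ?_)).le
  · intro a ha
    refine hcrit _ (Submodule.smul_mem _ a hz₀) ?_
    rw [smul_mul_assoc, ← mul_smul_comm]
    exact (Submodule.mem_div_iff_forall_mul_mem.mp hz₀) _ (hmy a ha)
  · intro z hz
    obtain ⟨r, hr⟩ := hzy z hz
    refine Submodule.mem_sup.mpr ⟨z - (r * ↑u⁻¹) • z₀, hcrit _ ?_ ?_, (r * ↑u⁻¹) • z₀,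
      Submodule.mem_span_singleton.mpr ⟨_, rfl⟩, by ring⟩
    · exact Submodule.sub_mem _ hz (Submodule.smul_mem _ _ hz₀)
    · have h1 := W.sub_mem hr (W.smul_mem (r * ↑u⁻¹) hr₀)
      have h2 : (r * ↑u⁻¹ : R) • (u : R) • p = r • p := by
        rw [smul_smul, mul_assoc, Units.inv_mul, mul_one]
      rw [smul_sub, h2] at h1
      convert h1 using 1
      rw [sub_mul, smul_mul_assoc]
      ring

variable [IsNoetherianRing R] [Ring.KrullDimLE 1 R]

/-- Iterates `len_div_le_one` down a composition series from `A` to `B`. -/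
theorem lenNat_div_le {W : Submodule R K} {p : K} (hW : IsFrac R K W)
    (hsoc : ∀ z : K, (∀ a ∈ IsLocalRing.maximalIdeal R, a • z ∈ W) → z ∈ W ⊔ Submodule.span R {p})
    (hmp : ∀ a ∈ IsLocalRing.maximalIdeal R, a • p ∈ W) {B : Submodule R K} (hB : IsFrac R K B) :
    ∀ (n : ℕ) {A : Submodule R K}, IsFrac R K A → B ≤ A → lenNat A B = n →
      lenNat (W / B) (W / A) ≤ n := by
  intro n
  induction n with
  | zero =>
    intro A hA hBA h
    rw [eq_of_lenNat_eq_zero hA hB hBA h, lenNat_self]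
  | succ n ih =>
    intro A hA hBA h
    have hlt : B < A := lt_of_le_of_ne hBA (by rintro rfl; rw [lenNat_self] at h; omega)
    obtain ⟨C, hBC, hCA⟩ := exists_le_covBy hlt (hA.len_ne_top hB hBA)
    have hC := hB.of_le hA hBC hCA.le
    have h1 : lenNat A C = 1 := by rw [lenNat, len_eq_one_of_covBy hCA]; rfl
    have h2 := lenNat_add hA hB hBC hCA.le
    have h3 := lenNat_add (hW.div hB) (hW.div hA) (div_mono (le_refl W) hCA.le)
      (div_mono (le_refl W) hBC)
    have h4 : lenNat (W / C) (W / A) ≤ 1 := ENat.toNat_le_of_le_natCast (len_div_le_one hsoc hmp hCA)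
    have h5 := ih hC hBC (by omega)
    omega

end Socle

/-! ### Existence of a normalized canonical ideal. -/

section Existence

variable {R : Type*} [CommRing R] [IsDomain R] [IsLocalRing R] {K : Type*} [Field K] [Algebra R K]
  [IsFractionRing R K] [Module.Finite R (integralClosure R K)]
  [IsDiscreteValuationRing (integralClosure R K)]

theorem mem_normalization_or_inv_mem (z : K) :
    z ∈ normalization R K ∨ z⁻¹ ∈ normalization R K := by
  obtain ⟨a, b, hb, rfl⟩ := IsFractionRing.div_surjective (A := R) z
  have hb' : algebraMap R K b ≠ 0 := IsFractionRing.to_map_ne_zero_of_mem_nonZeroDivisors hb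
  rcases eq_or_ne (algebraMap R K a) 0 with ha | ha
  · left; rw [ha, zero_div]; exact Submodule.zero_mem _
  rcases ValuationRing.dvd_total (algebraMap R (integralClosure R K) a)
    (algebraMap R (integralClosure R K) b) with ⟨c, hc⟩ | ⟨c, hc⟩
  · right
    have hc' : algebraMap R K b = algebraMap R K a * c := congrArg Subtype.val hc
    rw [inv_div, hc', mul_div_cancel_left₀ _ ha]
    exact c.2
  · left
    have hc' : algebraMap R K a = algebraMap R K b * c := congrArg Subtype.val hc
    rw [hc', mul_div_cancel_left₀ _ hb']
    exact c.2

theorem dvd_of_not_isUnit {t y : integralClosure R K} (ht : Irreducible t) (hy : ¬ IsUnit y) :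
    t ∣ y := by
  rw [← Ideal.mem_span_singleton, ← ht.maximalIdeal_eq]
  exact hy

/-- If `z` is not in `R̄`, its inverse is divisible by the uniformizer. -/
theorem exists_inv_eq_mul {t : integralClosure R K} (ht : Irreducible t) {z : K}
    (hz : z ∉ normalization R K) : ∃ y : integralClosure R K, z⁻¹ = t * y := by
  have hz' := (mem_normalization_or_inv_mem (R := R) z).resolve_left hz
  have hnu : ¬ IsUnit (⟨z⁻¹, hz'⟩ : integralClosure R K) := by
    rintro ⟨u, hu⟩
    have h1 : z⁻¹ * ((u⁻¹ : (integralClosure R K)ˣ) : integralClosure R K) = 1 := by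
      have := congrArg Subtype.val u.mul_inv
      rw [hu] at this
      exact this
    have h2 := eq_inv_of_mul_eq_one_right h1
    rw [inv_inv] at h2
    exact hz (h2 ▸ Subtype.prop _)
  obtain ⟨y, hy⟩ := dvd_of_not_isUnit ht hnu
  exact ⟨y, congrArg Subtype.val hy⟩

variable [IsNoetherianRing R] [Ring.KrullDimLE 1 R]

/-- A fractional ideal `R ⊆ W ⊆ R̄` with `W : R̄ = γ` and simple socle of `K / W` is canonical. -/
theorem isCanonicalIdeal_of_socle {W : Submodule R K} {p : K} (h1W : 1 ≤ W)
    (hWN : W ≤ normalization R K) (hWγ : W / normalization R K = conductorIdeal R K)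
    (hsoc : ∀ z : K, (∀ a ∈ IsLocalRing.maximalIdeal R, a • z ∈ W) → z ∈ W ⊔ Submodule.span R {p})
    (hmp : ∀ a ∈ IsLocalRing.maximalIdeal R, a • p ∈ W) : IsCanonicalIdeal R K W := by
  have hW : IsFrac R K W := isFrac_one.of_le isFrac_normalization h1W hWN
  obtain ⟨g, hg, hγ⟩ := exists_conductorIdeal_eq R K
  have hg' : (g : K) ≠ 0 := by simpa using hg
  refine ⟨hW.1, hW.2, fun J hJ0 hJf => ?_⟩
  have hJ : IsFrac R K J := ⟨hJ0, hJf⟩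
  obtain ⟨_, d, hd, hJd⟩ := isFrac_iff.mp hJ
  obtain ⟨j, hj, -, hjJ⟩ := hJ.exists_mem
  -- `J` is sandwiched between two multiples of `R̄`. These are reflexive with respect to `W`,
  -- because `W : eR̄ = e⁻¹gR̄`.
  set A := Submodule.span R {d} * normalization R K with hA
  set B := Submodule.span R {j * g} * normalization R K with hB
  have hjg : j * g ≠ 0 := mul_ne_zero hj hg'
  have hAf : IsFrac R K A := (isFrac_span hd).mul isFrac_normalization
  have hBf : IsFrac R K B := (isFrac_span hjg).mul isFrac_normalization
  have hJA : J ≤ A := hJd.trans (by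
    simpa using mul_le_mul_of_le (le_refl (Submodule.span R {d}))
      (one_le_normalization (R := R) (K := K)))
  have hBJ : B ≤ J := by
    refine le_trans ?_ hjJ
    rw [hB, ← Set.singleton_mul_singleton, ← Submodule.span_mul_span, mul_assoc, ← hγ]
    simpa using mul_le_mul_of_le (le_refl (Submodule.span R {j}))
      (conductorIdeal_le_one (R := R) (K := K))
  have hdiv : ∀ {e : K}, e ≠ 0 → W / (Submodule.span R {e} * normalization R K) =
      Submodule.span R {e⁻¹ * g} * normalization R K := by
    intro e he
    rw [div_span_mul he, hWγ, hγ, ← mul_assoc, Submodule.span_mul_span,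
      Set.singleton_mul_singleton]
  have hBB : W / (W / B) = B := by
    rw [hB, hdiv hjg, hdiv (mul_ne_zero (inv_ne_zero hjg) hg')]
    congr 3
    field_simp
  have hAB : lenNat (W / B) (W / A) = lenNat A B := by
    have hs : j * g * d * (g : K)⁻¹ ≠ 0 := by positivity
    rw [← lenNat_span_mul hs, hA, hB, hdiv hjg, hdiv hd, ← mul_assoc, ← mul_assoc,
      Submodule.span_mul_span, Submodule.span_mul_span, Set.singleton_mul_singleton,
      Set.singleton_mul_singleton]
    congr 4 <;> field_simp
  have e1 := lenNat_div_le hW hsoc hmp hJ _ hAf hJA rfl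
  -- As `B` is its own bidual, `e5` and `e2` give `ℓ((W : (W : J))/B) ≤ ℓ((W : B)/(W : J)) ≤
  -- ℓ(J/B)`. Since `J ⊆ W : (W : J)`, equality follows.
  have e2 := lenNat_div_le hW hsoc hmp hBf _ hJ hBJ rfl
  have e3 := lenNat_add hAf hBf hBJ hJA
  have e4 := lenNat_add (hW.div hBf) (hW.div hAf) (div_mono (le_refl W) hJA)
    (div_mono (le_refl W) hBJ)
  have e5 := lenNat_div_le hW hsoc hmp (hW.div hJ) _ (hW.div hBf) (div_mono le_rfl hBJ) rfl
  rw [hBB] at e5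
  have e6 := lenNat_add (hW.div (hW.div hJ)) hBf hBJ (le_div_div W J)
  exact eq_of_lenNat_eq_zero (hW.div (hW.div hJ)) hJ (le_div_div W J) (by omega)

/-- Let `p = g/t`, of value one less than the conductor. A submodule `W ⊇ R` maximal with `W ∩ pR̄ ⊆
γ` does not contain `p`, while every strictly larger one does; hence `p` spans the socle of `K/W`.
-/
theorem exists_isNormalizedCanonicalIdeal
    (hres : Function.Surjective ((IsLocalRing.residue (integralClosure R K)).comp
      (algebraMap R (integralClosure R K)))) :
    ∃ W : Submodule R K, IsNormalizedCanonicalIdeal R K W := by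
  obtain ⟨g, hg, hγ⟩ := exists_conductorIdeal_eq R K
  obtain ⟨t, ht⟩ := IsDiscreteValuationRing.exists_irreducible (integralClosure R K)
  have hg' : (g : K) ≠ 0 := by simpa using hg
  have ht' : (t : K) ≠ 0 := by simpa using ht.ne_zero
  have hγmem : ∀ y : integralClosure R K, (g : K) * y ∈ conductorIdeal R K := fun y => by
    rw [hγ]; exact mem_span_mul.mpr ⟨y, y.2, rfl⟩
  set p : K := g / t with hp
  have hgp : (g : K) = p * t := by rw [hp]; field_simp
  set a := Submodule.span R {p} * normalization R K with ha
  have hpa : p ∈ a := mem_span_mul.mpr ⟨1, (integralClosure R K).one_mem, mul_one p⟩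
  have hpγ : p ∉ conductorIdeal R K := by
    rw [hγ, mem_span_mul]
    rintro ⟨y, hy, hgy⟩
    refine ht.not_isUnit (IsUnit.of_mul_eq_one ⟨y, hy⟩ (Subtype.ext ?_))
    change (t : K) * y = 1
    have : p ≠ 0 := div_ne_zero hg' ht'
    rw [hgp, mul_assoc] at hgy
    exact mul_left_cancel₀ this (hgy.trans (mul_one p).symm)
  have hmp : ∀ r ∈ IsLocalRing.maximalIdeal R, r • p ∈ conductorIdeal R K := by
    intro r hr
    obtain ⟨y, hy⟩ := dvd_of_not_isUnit ht (not_isUnit_algebraMap (K := K) hr)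
    have hy' : algebraMap R K r = t * y := congrArg Subtype.val hy
    rw [Algebra.smul_def, hy', mul_right_comm, mul_comm (t : K), ← hgp]
    exact hγmem y
  -- `pR̄/γ` is one-dimensional over the common residue field, so any nonzero class generates it.
  have hsimple : ∀ z ∈ a, z ∉ conductorIdeal R K →
      a ≤ conductorIdeal R K ⊔ Submodule.span R {z} := by
    intro z hz hzγ q hq
    obtain ⟨w, hw, rfl⟩ := mem_span_mul.mp hz
    obtain ⟨v, hv, rfl⟩ := mem_span_mul.mp hq
    have hwu : IsUnit (⟨w, hw⟩ : integralClosure R K) := by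
      by_contra hwu
      obtain ⟨y, hy⟩ := dvd_of_not_isUnit ht hwu
      have hy' : w = t * y := congrArg Subtype.val hy
      rw [hy', ← mul_assoc, ← hgp] at hzγ
      exact hzγ (hγmem y)
    obtain ⟨u, hu⟩ := hwu
    obtain ⟨r, hr⟩ := exists_not_isUnit_sub_algebraMap hres (⟨v, hv⟩ * ((u⁻¹ : (integralClosure R K)ˣ) :
      integralClosure R K))
    obtain ⟨y, hy⟩ := dvd_of_not_isUnit ht hr
    have hy2 : (⟨v, hv⟩ : integralClosure R K) = (u : integralClosure R K) *
        (algebraMap R _ r + t * y) := by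
      rw [← hy, add_sub_cancel, mul_left_comm, Units.mul_inv, mul_one]
    rw [hu] at hy2
    have hy' : v = w * (algebraMap R K r + t * y) := congrArg Subtype.val hy2
    refine Submodule.mem_sup.mpr ⟨g * (⟨w, hw⟩ * y : integralClosure R K), hγmem _, r • (p * w),
      Submodule.mem_span_singleton.mpr ⟨r, rfl⟩, ?_⟩
    rw [Algebra.smul_def, hy', hgp]
    change p * t * (w * y) + _ = _
    ring
  -- An element of `R ∩ pR̄` outside `γ` would force `pR̄ ⊆ R`, that is, `p ∈ γ`.
  have h1a : 1 ⊓ a ≤ conductorIdeal R K := by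
    intro z hz
    by_contra hzγ
    have hale := (hsimple z hz.2 hzγ).trans
      (sup_le conductorIdeal_le_one (by simpa using hz.1))
    refine hpγ (Submodule.mem_div_iff_forall_mul_mem.mpr fun y hy => hale ?_)
    exact mem_span_mul.mpr ⟨y, hy, rfl⟩
  obtain ⟨W, h1W, hWmax⟩ := zorn_le_nonempty₀
    {W : Submodule R K | 1 ≤ W ∧ W ⊓ a ≤ conductorIdeal R K} (by
      intro c hc hchain y hy
      refine ⟨sSup c, ⟨(hc hy).1.trans (le_sSup hy), ?_⟩, fun z hz => le_sSup hz⟩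
      rintro z ⟨hz, hza⟩
      obtain ⟨V, hV, hzV⟩ := (Submodule.mem_sSup_of_directed ⟨y, hy⟩ hchain.directedOn).mp hz
      exact (hc hV).2 ⟨hzV, hza⟩) 1 ⟨le_rfl, h1a⟩
  obtain ⟨-, hWa⟩ := hWmax.prop
  have hγW : conductorIdeal R K ≤ W := conductorIdeal_le_one.trans h1W
  have hpW : p ∉ W := fun h => hpγ (hWa ⟨h, hpa⟩)
  have hsoc : ∀ z : K, (∀ r ∈ IsLocalRing.maximalIdeal R, r • z ∈ W) →
      z ∈ W ⊔ Submodule.span R {p} := by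
    intro z hz
    by_cases hzW : z ∈ W
    · exact Submodule.mem_sup_left hzW
    have hnot : ¬ ((W ⊔ Submodule.span R {z}) ⊓ a ≤ conductorIdeal R K) := by
      intro hcon
      have := hWmax.le_of_ge ⟨h1W.trans le_sup_left, hcon⟩ le_sup_left
      exact hzW (this (Submodule.mem_sup_right (Submodule.mem_span_singleton_self z)))
    obtain ⟨q, ⟨hq, hqa⟩, hqγ⟩ := SetLike.not_le_iff_exists.mp hnot
    have hp2 : p ∈ W ⊔ Submodule.span R {z} :=
      (sup_le (hγW.trans le_sup_left) (by simpa using hq)) (hsimple q hqa hqγ hpa)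
    obtain ⟨w, hw, c, hc, hwc⟩ := Submodule.mem_sup.mp hp2
    obtain ⟨r, rfl⟩ := Submodule.mem_span_singleton.mp hc
    have hr : IsUnit r := by
      by_contra hr
      exact hpW (hwc ▸ W.add_mem hw (hz r hr))
    obtain ⟨u, rfl⟩ := hr
    refine Submodule.mem_sup.mpr ⟨-((↑u⁻¹ : R) • w), W.neg_mem (W.smul_mem _ hw),
      (↑u⁻¹ : R) • p, Submodule.mem_span_singleton.mpr ⟨_, rfl⟩, ?_⟩
    rw [← hwc, smul_add, smul_smul, Units.inv_mul, one_smul, neg_add_cancel_left]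
  have hWN : W ≤ normalization R K := by
    -- If `w ∉ R̄`, then `w⁻¹ = ty` and `p = (gy)w` with `gy ∈ γ ⊆ R`, contradicting `p ∉ W`.
    intro w hw
    by_contra hwN
    have hw0 : w ≠ 0 := by rintro rfl; exact hwN (Submodule.zero_mem _)
    obtain ⟨y, hy⟩ := exists_inv_eq_mul ht hwN
    obtain ⟨r, hr⟩ := Submodule.mem_one.mp (conductorIdeal_le_one (hγmem y))
    refine hpW ?_
    have : p = r • w := by
      rw [Algebra.smul_def, hr, hgp, mul_assoc p, ← hy, mul_assoc, inv_mul_cancel₀ hw0, mul_one]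
    rw [this]
    exact W.smul_mem r hw
  have hWγ : W / normalization R K = conductorIdeal R K := by
    refine le_antisymm (fun z hz => ?_) (div_mono h1W le_rfl)
    by_contra hzγ
    have hz0 : z ≠ 0 := by rintro rfl; exact hzγ (Submodule.zero_mem _)
    -- For `z ∈ W : R̄` outside `γ`, `g/z = ty` gives `p = zy ∈ W`, again a contradiction.
    have hzg : z / g ∉ normalization R K := fun h => hzγ (by
      rw [hγ]; exact mem_span_mul.mpr ⟨z / g, h, by field_simp⟩)
    obtain ⟨y, hy⟩ := exists_inv_eq_mul ht hzg
    refine hpW ?_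
    have : p = z * y := by
      rw [inv_div, div_eq_iff hz0] at hy
      rw [hp, div_eq_iff ht', hy]
      ring
    rw [this]
    exact Submodule.mem_div_iff_forall_mul_mem.mp hz y y.2
  exact ⟨W, isCanonicalIdeal_of_socle h1W hWN hWγ hsoc fun r hr => hγW (hmp r hr), h1W, hWN⟩

end Existence

end CurveBlowup

namespace CurveBlowup

/-! ### Minimal reductions and the structure of the blowing-up. -/

section Reduction

variable {R : Type*} [CommRing R] [IsDomain R] [IsNoetherianRing R] {K : Type*} [Field K]
  [Algebra R K] [IsFractionRing R K]

variable (K) in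
-- For `x` of least value in `I`, the module `E = x⁻¹I` satisfies `R ⊆ E ⊆ R̄`. The powers of `E`
-- increase inside the Noetherian module `R̄`, so they stabilize, and `I^n = x^n E^n`.
theorem exists_isMinimalReduction [Module.Finite R (integralClosure R K)]
    [IsDiscreteValuationRing (integralClosure R K)] {I : Ideal R} (hI : I ≠ ⊥) :
    ∃ x, IsMinimalReduction I x := by
  obtain ⟨x, hxI, hmin⟩ := (InvImage.wf (val R K) wellFounded_lt).has_min (I : Set R)
    ⟨0, I.zero_mem⟩
  have hdvd : ∀ y ∈ I, algebraMap R (integralClosure R K) x ∣ algebraMap R _ y := fun y hy =>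
    IsDiscreteValuationRing.addVal_le_iff_dvd.mp (not_lt.mp (hmin y hy))
  have hx0 : x ≠ 0 := by
    rintro rfl
    refine hI ((Submodule.eq_bot_iff _).mpr fun y hy => ?_)
    obtain ⟨c, hc⟩ := hdvd y hy
    have hc' := congrArg Subtype.val hc
    rw [map_zero, zero_mul] at hc'
    exact (map_eq_zero_iff _ (IsFractionRing.injective R K)).mp hc'
  set X := algebraMap R K x with hX
  have hX0 : X ≠ 0 := (map_ne_zero_iff _ (IsFractionRing.injective R K)).mpr hx0
  set E := Submodule.span R {X⁻¹} * inK K I with hE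
  have hEN : E ≤ normalization R K := by
    intro z hz
    obtain ⟨y, hy, rfl⟩ := mem_span_mul.mp hz
    obtain ⟨y, hyI, rfl⟩ := (IsLocalization.mem_coeSubmodule K _).mp hy
    obtain ⟨c, hc⟩ := hdvd y hyI
    have hc' : algebraMap R K y = X * c := congrArg Subtype.val hc
    rw [hc', inv_mul_cancel_left₀ hX0]
    exact c.2
  have h1E : 1 ≤ E := by
    rw [Submodule.one_le]
    exact mem_span_mul.mpr ⟨X, mem_inK.mpr hxI, inv_mul_cancel₀ hX0⟩
  have hEnN : ∀ n, E ^ n ≤ normalization R K := by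
    intro n
    induction n with
    | zero => rw [pow_zero]; exact one_le_normalization
    | succ n ih =>
      rw [pow_succ, ← normalization_mul_self]
      exact mul_le_mul_of_le ih hEN
  have hmono : Monotone fun n => E ^ n := monotone_nat_of_le_succ fun n => by
    simpa [pow_succ] using mul_le_mul_of_le (le_refl (E ^ n)) h1E
  have hnoeth : IsNoetherian R (normalization R K) :=
    isNoetherian_of_isNoetherianRing_of_finite R (integralClosure R K)
  obtain ⟨m, hm⟩ := monotone_stabilizes_iff_noetherian.mpr hnoeth
    ⟨fun n => (E ^ n).comap (normalization R K).subtype,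
      fun a b hab => Submodule.comap_mono (hmono hab)⟩
  have hstab : ∀ n ≥ m, E ^ n = E ^ m := by
    intro n hn
    have h := congrArg (Submodule.map (normalization R K).subtype) (hm n hn)
    change ((E ^ m).comap (normalization R K).subtype).map (normalization R K).subtype =
      ((E ^ n).comap (normalization R K).subtype).map (normalization R K).subtype at h
    rw [Submodule.map_comap_subtype, Submodule.map_comap_subtype, inf_eq_right.mpr (hEnN m),
      inf_eq_right.mpr (hEnN n)] at h
    exact h.symm
  refine ⟨x, hxI, m, fun n hn => IsFractionRing.coeSubmodule_injective R K ?_⟩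
  change inK K _ = inK K _
  have hL : inK K I = Submodule.span R {X} * E := (span_mul_cancel hX0 _).symm
  clear_value E
  rw [inK_mul, inK_pow, inK_pow, inK_span, hL, mul_pow, mul_pow, hstab (n + 1) (by omega),
    hstab n hn, pow_succ', mul_assoc]

theorem reductionExponent_spec {I : Ideal R} {x : R} (h : IsMinimalReduction I x) :
    ∀ n ≥ reductionExponent I x, I ^ (n + 1) = Ideal.span {x} * I ^ n :=
  Nat.sInf_mem h.2

theorem ideal_pow_ne_bot {I : Ideal R} (hI : I ≠ ⊥) (n : ℕ) : I ^ n ≠ ⊥ := pow_ne_zero n hI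

theorem ne_zero_of_isMinimalReduction {I : Ideal R} {x : R} (hI : I ≠ ⊥)
    (h : IsMinimalReduction I x) : algebraMap R K x ≠ 0 := by
  rw [map_ne_zero_iff _ (IsFractionRing.injective R K)]
  rintro rfl
  obtain ⟨m, hm⟩ := h.2
  have := hm m le_rfl
  rw [Ideal.span_singleton_eq_bot.mpr rfl, Ideal.bot_mul] at this
  exact ideal_pow_ne_bot hI (m + 1) this

variable {I : Ideal R} {x : R} {ν : ℕ}

theorem inK_pow_add (hν : ∀ n ≥ ν, I ^ (n + 1) = Ideal.span {x} * I ^ n) (n k : ℕ) (hn : ν ≤ n) :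
    inK K I ^ (n + k) = Submodule.span R {algebraMap R K x ^ k} * inK K I ^ n := by
  induction k with
  | zero => rw [pow_zero, ← Submodule.one_eq_span, one_mul, add_zero]
  | succ k ih =>
    rw [← add_assoc, ← inK_pow, hν _ (by omega), inK_mul, inK_pow, ih, inK_span, ← mul_assoc,
      Submodule.span_mul_span, Set.singleton_mul_singleton, pow_succ']

/-- Since `x^n ∈ I^n`, the colon lies in `x⁻ⁿI^n`; conversely `I^n I^n = x^n I^n` for `n ≥ ν`. Thus
the union defining `Λ` is attained at `ν`. -/
theorem div_self_inK_pow (hx : x ∈ I) (hx0 : algebraMap R K x ≠ 0)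
    (hν : ∀ n ≥ ν, I ^ (n + 1) = Ideal.span {x} * I ^ n) (n : ℕ) (hn : ν ≤ n) :
    inK K I ^ n / inK K I ^ n = Submodule.span R {(algebraMap R K x ^ ν)⁻¹} * inK K I ^ ν := by
  have hXn : ∀ n : ℕ, algebraMap R K x ^ n ≠ 0 := fun n => pow_ne_zero n hx0
  have h1 : Submodule.span R {(algebraMap R K x ^ n)⁻¹} * inK K I ^ n =
      Submodule.span R {(algebraMap R K x ^ ν)⁻¹} * inK K I ^ ν := by
    obtain ⟨k, rfl⟩ := Nat.exists_eq_add_of_le hn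
    rw [inK_pow_add hν ν k le_rfl, ← mul_assoc, Submodule.span_mul_span,
      Set.singleton_mul_singleton]
    congr 3
    rw [pow_add]
    field_simp [hXn ν, hXn k]
  rw [← h1]
  refine le_antisymm ?_ ?_
  · have hspan : Submodule.span R {algebraMap R K x ^ n} * 1 ≤ inK K I ^ n := by
      rw [mul_one, ← span_pow, ← inK_span, ← inK_pow, ← inK_pow]
      exact inK_le_inK.mpr (Ideal.pow_right_mono (by simpa using hx) n)
    refine (div_mono le_rfl hspan).trans ?_
    rw [div_span_mul (hXn n), div_one_eq]
  · rw [Submodule.le_div_iff_mul_le, mul_assoc, ← pow_add, inK_pow_add hν n n hn,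
      span_inv_mul_cancel (hXn n)]

theorem blowupMod_eq (hx : x ∈ I) (hx0 : algebraMap R K x ≠ 0)
    (hν : ∀ n ≥ ν, I ^ (n + 1) = Ideal.span {x} * I ^ n) :
    blowupMod K I = Submodule.span R {(algebraMap R K x ^ ν)⁻¹} * inK K I ^ ν := by
  rw [← div_self_inK_pow hx hx0 hν ν le_rfl]
  ext z
  constructor
  · rintro ⟨n, hn⟩
    have := colon_self_mono K (inK K I) (le_max_left n ν) hn
    beta_reduce at this
    rwa [div_self_inK_pow hx hx0 hν _ (le_max_right n ν),
      ← div_self_inK_pow hx hx0 hν ν le_rfl] at this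
  · exact fun h => ⟨ν, h⟩

theorem inK_pow_eq_span_mul_blowupMod (hx : x ∈ I) (hx0 : algebraMap R K x ≠ 0)
    (hν : ∀ n ≥ ν, I ^ (n + 1) = Ideal.span {x} * I ^ n) (n : ℕ) (hn : ν ≤ n) :
    inK K (I ^ n) = Submodule.span R {algebraMap R K x ^ n} * blowupMod K I := by
  rw [blowupMod_eq hx hx0 fun m hm => hν m (hn.trans hm), span_mul_cancel (pow_ne_zero n hx0),
    inK_pow]

theorem isFrac_blowupMod (hI : I ≠ ⊥) (h : IsMinimalReduction I x) :
    IsFrac R K (blowupMod K I) := by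
  have hx0 := ne_zero_of_isMinimalReduction (K := K) hI h
  rw [blowupMod_eq h.1 hx0 (reductionExponent_spec h), ← inK_pow]
  exact (isFrac_span (inv_ne_zero (pow_ne_zero _ hx0))).mul
    (isFrac_inK (ideal_pow_ne_bot hI _))

theorem blowupMod_le_normalization (hI : I ≠ ⊥) (h : IsMinimalReduction I x) :
    blowupMod K I ≤ normalization R K := by
  have hx0 := ne_zero_of_isMinimalReduction (K := K) hI h
  have hfg : (blowupMod K I).FG := by
    rw [blowupMod_eq h.1 hx0 (reductionExponent_spec h), ← inK_pow]
    refine (Submodule.fg_span_singleton _).mul ?_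
    exact (IsNoetherian.noetherian (I ^ _)).map _
  exact fun z hz => IsIntegral.of_mem_of_fg _ hfg z hz

/-- If `Λ = R`, then `I^ν = x^ν R` and `I^(ν+1) = x^(ν+1) R`; cancelling `x^ν` gives `I = (x)`. -/
theorem blowupMod_ne_one (hI : I ≠ ⊥) (h : IsMinimalReduction I x)
    (hprinc : ¬ Submodule.IsPrincipal I) : blowupMod K I ≠ 1 := by
  intro h1
  have hx0 := ne_zero_of_isMinimalReduction (K := K) hI h
  have hν := reductionExponent_spec h
  set ν := reductionExponent I x
  have e1 := inK_pow_eq_span_mul_blowupMod (K := K) h.1 hx0 hν ν le_rfl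
  have e2 := inK_pow_eq_span_mul_blowupMod (K := K) h.1 hx0 hν (ν + 1) (Nat.le_succ ν)
  rw [pow_succ, inK_mul, e1, h1, mul_one, mul_one, pow_succ, ← Set.singleton_mul_singleton,
    ← Submodule.span_mul_span] at e2
  have e3 := span_mul_injective (pow_ne_zero ν hx0) e2
  rw [← inK_span] at e3
  exact hprinc ⟨x, IsFractionRing.coeSubmodule_injective R K e3⟩

theorem span_mul_blowupMod_le (x : R) :
    Submodule.span R {algebraMap R K x} * blowupMod K I ≤ blowupMod K I := by
  intro z hz
  obtain ⟨y, hy, rfl⟩ := mem_span_mul.mp hz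
  rw [← Algebra.smul_def]
  exact Submodule.smul_mem _ x hy

/-! ### The Hilbert series, multiplicity and genus. -/

variable [Ring.KrullDimLE 1 R]

theorem hilbertFn_eq (n : ℕ) : hilbertFn I n = len (inK K (I ^ n)) (inK K (I ^ (n + 1))) :=
  (len_inK _ _).symm

theorem isFrac_inK_pow (hI : I ≠ ⊥) (n : ℕ) : IsFrac R K (inK K (I ^ n)) :=
  isFrac_inK (ideal_pow_ne_bot hI n)

theorem inK_pow_succ_le (n : ℕ) : inK K (I ^ (n + 1)) ≤ inK K (I ^ n) :=
  inK_le_inK.mpr (Ideal.pow_le_pow_right (Nat.le_succ n))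

theorem hilbertFn_ne_top (K : Type*) [Field K] [Algebra R K] [IsFractionRing R K] (hI : I ≠ ⊥) (n : ℕ) : hilbertFn I n ≠ ⊤ := by
  rw [hilbertFn_eq (K := K)]
  exact (isFrac_inK_pow hI n).len_ne_top (isFrac_inK_pow hI (n + 1)) (inK_pow_succ_le n)

theorem sum_hilbertFn (hI : I ≠ ⊥) (n : ℕ) :
    ∑ j ∈ Finset.range n, (hilbertFn I j).toNat = lenNat (1 : Submodule R K) (inK K (I ^ n)) := by
  induction n with
  | zero => rw [pow_zero, Ideal.one_eq_top, inK_top, lenNat_self, Finset.sum_range_zero]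
  | succ n ih =>
    rw [Finset.sum_range_succ, ih, lenNat_add isFrac_one (isFrac_inK_pow hI (n + 1))
      (inK_pow_succ_le n) (inK_le_one _), hilbertFn_eq (K := K), add_comm]
    rfl

theorem hPolynomial_eq_of_isHPolynomial {I : Ideal R} {p : ℤ[X]} (hp : IsHPolynomial I p) :
    hPolynomial I = p := by
  have hex : ∃ p : ℤ[X], IsHPolynomial I p := ⟨p, hp⟩
  rw [hPolynomial, dif_pos hex]
  exact Polynomial.coe_injective ℤ ((show IsHPolynomial I _ from hex.choose_spec).trans hp.symm)

/-- If the Hilbert function equals `e` from `ν` on, the `h`-polynomial is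
`e + (1 - X) ∑_{j < ν} (H(j) - e) X ^ j`. -/
theorem isHPolynomial_of_eventually_const {I : Ideal R} {e : ℤ}
    (he : ∀ n ≥ ν, ((hilbertFn I n).toNat : ℤ) = e) :
    IsHPolynomial I (Polynomial.C e + (1 - Polynomial.X) * ∑ j ∈ Finset.range ν,
      Polynomial.C (((hilbertFn I j).toNat : ℤ) - e) * Polynomial.X ^ j) := by
  set Q := ∑ j ∈ Finset.range ν,
    Polynomial.C (((hilbertFn I j).toNat : ℤ) - e) * Polynomial.X ^ j with hQ
  have hser : hilbertSeries I = PowerSeries.C e * PowerSeries.mk 1 + (Q : ℤ⟦X⟧) := by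
    ext n
    rw [hilbertSeries, PowerSeries.coeff_mk, map_add, PowerSeries.coeff_C_mul,
      PowerSeries.coeff_mk, Polynomial.coeff_coe, hQ, Polynomial.finsetSum_coeff]
    simp only [Polynomial.coeff_C_mul_X_pow, Pi.one_apply, mul_one]
    rw [Finset.sum_ite_eq]
    split_ifs with h
    · ring
    · rw [add_zero]
      exact he n (by simpa using h)
  rw [IsHPolynomial, hser, mul_add, mul_left_comm, mul_comm (1 - PowerSeries.X) (PowerSeries.mk 1),
    PowerSeries.mk_one_mul_one_sub_eq_one, mul_one]
  push_cast
  rfl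

variable (K) in
-- From `ν` on, `I^n = x^n Λ`, so `H(n) = ℓ(Λ/xΛ) = e`. Differentiating `h` at `1` gives `ρ =
-- ∑_{j<ν} (e - H(j)) = eν - ℓ(R/I^ν)`, and `eν = ℓ(Λ/x^ν Λ) = ℓ(Λ/I^ν)`.
theorem isHPolynomial_and_idealMult_genus_eq (hI : I ≠ ⊥) (h : IsMinimalReduction I x) :
    IsHPolynomial I (hPolynomial I) ∧
    idealMult I * reductionExponent I x =
      lenNat (blowupMod K I) (inK K (I ^ reductionExponent I x)) ∧
    genus I = lenNat (blowupMod K I) 1 := by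
  have hx0 := ne_zero_of_isMinimalReduction (K := K) hI h
  have hν := reductionExponent_spec h
  set ν := reductionExponent I x
  have hΛ := isFrac_blowupMod (K := K) hI h
  set e := lenNat (blowupMod K I) (Submodule.span R {algebraMap R K x} * blowupMod K I) with he
  have hconst : ∀ n ≥ ν, ((hilbertFn I n).toNat : ℤ) = e := by
    intro n hn
    rw [hilbertFn_eq (K := K), inK_pow_eq_span_mul_blowupMod h.1 hx0 hν n hn,
      inK_pow_eq_span_mul_blowupMod h.1 hx0 hν (n + 1) (by omega), pow_succ,
      ← Set.singleton_mul_singleton, ← Submodule.span_mul_span, mul_assoc,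
      len_span_mul (pow_ne_zero n hx0)]
    rfl
  have hp := isHPolynomial_of_eventually_const hconst
  have hpeq := hPolynomial_eq_of_isHPolynomial hp
  have hmult : idealMult I = e := by
    rw [idealMult, hpeq]
    simp
  have hlen : lenNat (blowupMod K I) (inK K (I ^ ν)) = ν * e := by
    rw [inK_pow_eq_span_mul_blowupMod h.1 hx0 hν ν le_rfl]
    exact (lenNat_span_pow_mul hx0 hΛ (span_mul_blowupMod_le x) ν).2
  refine ⟨hpeq ▸ hp, ?_, ?_⟩
  · rw [hmult, hlen]
    push_cast
    ring
  · have hgenus : genus I = ν * e - lenNat (1 : Submodule R K) (inK K (I ^ ν)) := by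
      rw [genus, hpeq, ← sum_hilbertFn hI]
      simp [Polynomial.eval_finsetSum, Finset.sum_sub_distrib]
    have := lenNat_add hΛ (isFrac_inK_pow hI ν) (inK_le_one (I ^ ν)) (one_le_toSubmodule _)
    rw [hgenus]
    rw [hlen] at this
    have := congrArg (Nat.cast (R := ℤ)) this
    push_cast at this
    linarith

end Reduction

end CurveBlowup

namespace CurveBlowup

/-! ### Gorenstein overrings in terms of `R`-submodules. -/

section Gorenstein

variable {R : Type*} [CommRing R] [IsDomain R] {K : Type*} [Field K] [Algebra R K]
  [IsFractionRing R K]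

theorem toSubmodule_mul_eq_of_le {A : Subalgebra R K} {J : Submodule R K}
    (h : Subalgebra.toSubmodule A * J ≤ J) : Subalgebra.toSubmodule A * J = J :=
  le_antisymm h (by simpa using mul_le_mul_of_le (one_le_toSubmodule A) (le_refl J))

theorem toSubmodule_mul_div_eq {A : Subalgebra R K} {W J : Submodule R K}
    (h : Subalgebra.toSubmodule A * W ≤ W) : Subalgebra.toSubmodule A * (W / J) = W / J := by
  refine toSubmodule_mul_eq_of_le ?_
  rw [Submodule.le_div_iff_mul_le, mul_assoc]
  exact (mul_le_mul_of_le le_rfl (div_mul_le _ _)).trans h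

theorem toSubmodule_div_self (A : Subalgebra R K) :
    Subalgebra.toSubmodule A / Subalgebra.toSubmodule A = Subalgebra.toSubmodule A := by
  refine le_antisymm ?_ (Submodule.le_div_iff_mul_le.mpr (toSubmodule_mul_self A).le)
  have := div_mono (le_refl (Subalgebra.toSubmodule A)) (one_le_toSubmodule A)
  rwa [div_one_eq] at this

theorem restrictScalars_one (A : Subalgebra R K) :
    (1 : Submodule A K).restrictScalars R = Subalgebra.toSubmodule A := by
  ext z
  rw [Submodule.restrictScalars_mem, Submodule.mem_one]
  exact ⟨fun ⟨y, hy⟩ => hy ▸ y.2, fun hz => ⟨⟨z, hz⟩, rfl⟩⟩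

theorem restrictScalars_div (A : Subalgebra R K) (P Q : Submodule A K) :
    (P / Q).restrictScalars R = P.restrictScalars R / Q.restrictScalars R := by
  ext z
  rw [Submodule.restrictScalars_mem, Submodule.mem_div_iff_forall_mul_mem,
    Submodule.mem_div_iff_forall_mul_mem]
  rfl

theorem isFractional_restrictScalars_iff {A : Subalgebra R K}
    (hA : IsFrac R K (Subalgebra.toSubmodule A)) {J : Submodule A K} (hJ : J ≠ ⊥) :
    IsFractional A⁰ J ↔ IsFrac R K (J.restrictScalars R) := by
  constructor
  · rintro ⟨a, ha, h⟩
    have ha0 : (a : K) ≠ 0 := by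
      have := nonZeroDivisors.ne_zero ha
      simpa using this
    have hle : J.restrictScalars R ≤ Submodule.span R {(a : K)⁻¹} * Subalgebra.toSubmodule A := by
      intro z hz
      obtain ⟨y, hy⟩ := h z hz
      refine mem_span_mul.mpr ⟨y, y.2, ?_⟩
      have hy' : (y : K) = a * z := hy
      rw [hy', inv_mul_cancel_left₀ ha0]
    obtain ⟨_, d, hd, h2⟩ := isFrac_iff.mp ((isFrac_span (inv_ne_zero ha0)).mul hA)
    refine isFrac_iff.mpr ⟨?_, d, hd, hle.trans h2⟩
    rwa [Ne, Submodule.restrictScalars_eq_bot_iff]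
  · rintro ⟨-, r, hr, h⟩
    refine ⟨algebraMap R A r, mem_nonZeroDivisors_of_ne_zero fun h0 => ?_, fun b hb => ?_⟩
    · have h0' : algebraMap R K r = 0 := congrArg Subtype.val h0
      exact IsFractionRing.to_map_ne_zero_of_mem_nonZeroDivisors hr h0'
    · obtain ⟨y, hy⟩ := h b hb
      refine ⟨algebraMap R A y, ?_⟩
      rw [algebraMap_smul, ← hy]
      rfl

/-- An overring `A` of `R` is Gorenstein when `J ↦ A : J` is an involution on the fractional ideals
of `R` that are `A`-modules. -/
theorem isGorenstein_iff {A : Subalgebra R K} (hA : IsFrac R K (Subalgebra.toSubmodule A)) :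
    IsGorenstein A K ↔ ∀ J : Submodule R K, IsFrac R K J → Subalgebra.toSubmodule A * J ≤ J →
      Subalgebra.toSubmodule A / (Subalgebra.toSubmodule A / J) = J := by
  constructor
  · rintro ⟨-, -, h⟩ J hJ hAJ
    let J' : Submodule A K :=
      { carrier := J
        zero_mem' := J.zero_mem
        add_mem' := fun ha hb => J.add_mem ha hb
        smul_mem' := fun a z hz => hAJ (Submodule.mul_mem_mul a.2 hz) }
    have hJJ : J'.restrictScalars R = J := rfl
    have hJ'0 : J' ≠ ⊥ := fun h0 => hJ.1 (by
      rw [← hJJ, h0, Submodule.restrictScalars_bot])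
    have := congrArg (Submodule.restrictScalars R)
      (h J' hJ'0 ((isFractional_restrictScalars_iff hA hJ'0).mpr hJ))
    rwa [restrictScalars_div, restrictScalars_div, restrictScalars_one, hJJ] at this
  · intro h
    have h10 : (1 : Submodule A K) ≠ ⊥ := fun h0 => hA.1 (by
      rw [← restrictScalars_one, h0, Submodule.restrictScalars_bot])
    refine ⟨h10, (isFractional_restrictScalars_iff hA h10).mpr (by rwa [restrictScalars_one]),
      fun J hJ0 hJ => ?_⟩
    refine Submodule.restrictScalars_injective R A K ?_
    rw [restrictScalars_div, restrictScalars_div, restrictScalars_one]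
    refine h _ ((isFractional_restrictScalars_iff hA hJ0).mp hJ) (Submodule.mul_le.mpr ?_)
    exact fun a ha z hz => J.smul_mem ⟨a, ha⟩ hz

end Gorenstein

/-! ### The canonical ideal of an almost Gorenstein ring. -/

section Canonical

variable {R : Type*} [CommRing R] [IsDomain R] {K : Type*} [Field K] [Algebra R K]
  [IsFractionRing R K] {ω : Submodule R K}

theorem IsNormalizedCanonicalIdeal.div_normalization (hω : IsNormalizedCanonicalIdeal R K ω) :
    ω / normalization R K = conductorIdeal R K := by
  have h : ω * normalization R K = normalization R K := by
    refine le_antisymm ?_ ?_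
    · refine (mul_le_mul_of_le hω.2.2 le_rfl).trans normalization_mul_self.le
    · simpa using mul_le_mul_of_le hω.2.1 (le_refl (normalization R K))
  rw [conductorIdeal, ← hω.1.div_self, div_div_eq, h]

/-- Because `ω : ω = R`, this rewrites `R`-duals, which need not be reflexive, as `ω`-duals, which
are. -/
theorem IsCanonicalIdeal.one_div (hω : IsCanonicalIdeal R K ω) (J : Submodule R K) :
    1 / J = ω / (ω * J) := by
  rw [← div_div_eq, hω.div_self]

variable [IsLocalRing R] [IsNoetherianRing R] [Ring.KrullDimLE 1 R]
  [Module.Finite R (integralClosure R K)] [IsDiscreteValuationRing (integralClosure R K)]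

theorem isFrac_maximalIdeal (hne : normalization R K ≠ 1) :
    IsFrac R K (inK K (IsLocalRing.maximalIdeal R)) := by
  refine isFrac_inK fun hbot => hne (le_antisymm (fun z _ => ?_) one_le_normalization)
  have hfield := IsLocalRing.isField_iff_maximalIdeal_eq.mpr hbot
  obtain ⟨a, b, hb, rfl⟩ := IsFractionRing.div_surjective (A := R) z
  obtain ⟨c, hc⟩ := hfield.mul_inv_cancel (nonZeroDivisors.ne_zero hb)
  refine Submodule.mem_one.mpr ⟨a * c, ?_⟩
  rw [eq_div_iff (IsFractionRing.to_map_ne_zero_of_mem_nonZeroDivisors hb), ← map_mul, mul_assoc,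
    mul_comm c b, hc, mul_one]

theorem conductorIdeal_ne_one (hne : normalization R K ≠ 1) : conductorIdeal R K ≠ 1 := by
  intro h
  have := one_div_conductorIdeal (R := R) (K := K)
  rw [h, div_one_eq] at this
  exact hne this.symm

theorem cmType_ne_top
    (hres : Function.Surjective ((IsLocalRing.residue (integralClosure R K)).comp
      (algebraMap R (integralClosure R K)))) (hne : normalization R K ≠ 1) :
    cmType R K ≠ ⊤ := by
  rw [cmType_eq hres]
  exact (isFrac_one.div (isFrac_maximalIdeal hne)).len_ne_top isFrac_one
    (Submodule.one_le_one_div.mpr (inK_le_one _))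

/-- Duality gives `ℓ(R̄/ω) = ℓ((ω : ω)/(ω : R̄)) = ℓ(R/γ)`; subtract it from `ℓ(R̄/R) = ℓ(R/γ) + r -
1`. -/
theorem IsNormalizedCanonicalIdeal.lenNat_one_add_one (hω : IsNormalizedCanonicalIdeal R K ω)
    (hAG : IsAlmostGorenstein R K)
    (hres : Function.Surjective ((IsLocalRing.residue (integralClosure R K)).comp
      (algebraMap R (integralClosure R K)))) (hne : normalization R K ≠ 1) :
    lenNat ω 1 + 1 = (cmType R K).toNat := by
  have hN := isFrac_normalization (R := R) (K := K)
  have h1 := hAG.len_normalization hres (conductorIdeal_ne_one hne)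
  rw [← hN.coe_lenNat isFrac_one one_le_normalization,
    ← ENat.natCast_toNat (cmType_ne_top hres hne),
    ← isFrac_one.coe_lenNat isFrac_conductorIdeal conductorIdeal_le_one] at h1
  have h1' : lenNat (normalization R K) 1 + 1 =
      (cmType R K).toNat + lenNat 1 (conductorIdeal R K) := by exact_mod_cast h1
  have h2 := hω.1.lenNat_div hN hω.1.isFrac hω.2.2
  rw [hω.1.div_self, hω.div_normalization] at h2
  have h3 := lenNat_add hN isFrac_one hω.2.1 hω.2.2
  omega

/-- If `R` is almost Gorenstein, then `ω 𝔪 = 𝔪`. -/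
theorem IsNormalizedCanonicalIdeal.mul_maximalIdeal (hω : IsNormalizedCanonicalIdeal R K ω)
    (hAG : IsAlmostGorenstein R K)
    (hres : Function.Surjective ((IsLocalRing.residue (integralClosure R K)).comp
      (algebraMap R (integralClosure R K)))) (hne : normalization R K ≠ 1) :
    ω * inK K (IsLocalRing.maximalIdeal R) = inK K (IsLocalRing.maximalIdeal R) := by
  have hm := isFrac_maximalIdeal hne
  set m := inK K (IsLocalRing.maximalIdeal R) with hmdef
  have hm1 : m ≤ 1 := inK_le_one _
  have hωm : m ≤ ω * m := by simpa using mul_le_mul_of_le hω.2.1 (le_refl m)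
  have hωmω : ω * m ≤ ω := by simpa using mul_le_mul_of_le (le_refl ω) hm1
  -- `ℓ(ω/ω𝔪) = ℓ((R : 𝔪)/R) = r`, and also `ℓ(ω/𝔪) = ℓ(ω/R) + 1 = r`, so `𝔪 ⊆ ω𝔪` is an equality.
  have h1 := hω.1.lenNat_div hω.1.isFrac (hω.1.isFrac.mul hm) hωmω
  rw [← hω.1.one_div, hω.1.div_self] at h1
  have h2 : lenNat (1 / m) 1 = (cmType R K).toNat := by rw [cmType_eq hres]; rfl
  have h3 : lenNat 1 m = 1 := by
    rw [lenNat, hmdef, ← valIdeal_one hres, len_one_valIdeal hres]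
    rfl
  have h4 := lenNat_add hω.1.isFrac hm hm1 hω.2.1
  have h5 := lenNat_add hω.1.isFrac hm hωm hωmω
  have h6 := hω.lenNat_one_add_one hAG hres hne
  exact eq_of_lenNat_eq_zero (hω.1.isFrac.mul hm) hm hωm (by omega)

/-- The dual of a proper overring of an almost Gorenstein ring is an `ω`-module. -/
theorem IsNormalizedCanonicalIdeal.mul_one_div (hω : IsNormalizedCanonicalIdeal R K ω)
    (hAG : IsAlmostGorenstein R K)
    (hres : Function.Surjective ((IsLocalRing.residue (integralClosure R K)).comp
      (algebraMap R (integralClosure R K)))) (hne : normalization R K ≠ 1) {A : Subalgebra R K}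
    (hA : Subalgebra.toSubmodule A ≠ 1) :
    ω * (1 / Subalgebra.toSubmodule A) = 1 / Subalgebra.toSubmodule A := by
  set Λ := Subalgebra.toSubmodule A with hΛ
  have h1Λ : 1 ≤ Λ := one_le_toSubmodule A
  have hJ1 : 1 / Λ ≤ 1 := by
    have := div_mono (le_refl (1 : Submodule R K)) h1Λ
    rwa [div_one_eq] at this
  -- A unit of `R` in `R : Λ` would put `1` there, that is, `Λ ⊆ R`.
  have hJm : 1 / Λ ≤ inK K (IsLocalRing.maximalIdeal R) := by
    intro z hz
    obtain ⟨a, rfl⟩ := Submodule.mem_one.mp (hJ1 hz)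
    refine mem_inK.mpr fun ha => hA (le_antisymm ?_ h1Λ)
    obtain ⟨u, rfl⟩ := ha
    have := (1 / Λ).smul_mem (↑u⁻¹ : R) hz
    rw [Algebra.smul_def, ← map_mul, Units.inv_mul, map_one] at this
    exact Submodule.one_mem_div.mp this
  refine le_antisymm ?_ (by simpa using mul_le_mul_of_le hω.2.1 (le_refl (1 / Λ)))
  rw [Submodule.le_div_iff_mul_le, mul_assoc]
  have hJΛ : 1 / Λ * Λ ≤ 1 / Λ := by
    rw [Submodule.le_div_iff_mul_le, mul_assoc, toSubmodule_mul_self]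
    exact div_mul_le _ _
  refine (mul_le_mul_of_le le_rfl (hJΛ.trans hJm)).trans ?_
  rw [hω.mul_maximalIdeal hAG hres hne]
  exact inK_le_one _

/-- For a proper overring `A` of an almost Gorenstein ring, `ℓ(A** / R) = ℓ(R / A*) + r - 1`. -/
theorem IsNormalizedCanonicalIdeal.lenNat_bidual (hω : IsNormalizedCanonicalIdeal R K ω)
    (hAG : IsAlmostGorenstein R K)
    (hres : Function.Surjective ((IsLocalRing.residue (integralClosure R K)).comp
      (algebraMap R (integralClosure R K)))) (hne : normalization R K ≠ 1) {A : Subalgebra R K}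
    (hAf : IsFrac R K (Subalgebra.toSubmodule A)) (hA : Subalgebra.toSubmodule A ≠ 1) :
    lenNat (1 / (1 / Subalgebra.toSubmodule A)) 1 + 1 =
      lenNat 1 (1 / Subalgebra.toSubmodule A) + (cmType R K).toNat := by
  set Λ := Subalgebra.toSubmodule A with hΛ
  have hωJ : ω * (1 / Λ) = 1 / Λ := hω.mul_one_div hAG hres hne hA
  have hJ := isFrac_one.div hAf
  have hJ1 : 1 / Λ ≤ 1 := by
    have := div_mono (le_refl (1 : Submodule R K)) (one_le_toSubmodule A)
    rwa [div_one_eq] at this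
  have h1 := hω.1.lenNat_div hω.1.isFrac hJ (hJ1.trans hω.2.1)
  -- So `Λ**` is the `ω`-dual of `Λ*`, and `ℓ(Λ**/R) = ℓ(ω/Λ*)`.
  have h2 : ω / (1 / Λ) = 1 / (1 / Λ) := by rw [hω.1.one_div (1 / Λ), hωJ]
  rw [h2, hω.1.div_self] at h1
  have h3 := lenNat_add hω.1.isFrac hJ hJ1 hω.2.1
  have h4 := hω.lenNat_one_add_one hAG hres hne
  omega

end Canonical

/-! ### The canonical ideal of a Gorenstein overring. -/

section GorensteinOverring

variable {R : Type*} [CommRing R] [IsDomain R] {K : Type*} [Field K] [Algebra R K]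
  [IsFractionRing R K] {ω : Submodule R K} {A : Subalgebra R K}

/-- If `ω : A` is a principal multiple of `A`, then `A` is Gorenstein. -/
theorem IsCanonicalIdeal.isGorenstein_of_div_eq (hω : IsCanonicalIdeal R K ω)
    (hA : IsFrac R K (Subalgebra.toSubmodule A)) {d : K} (hd : d ≠ 0)
    (h : ω / Subalgebra.toSubmodule A = Submodule.span R {d} * Subalgebra.toSubmodule A) :
    IsGorenstein A K := by
  refine (isGorenstein_iff hA).mpr fun J hJ hAJ => ?_
  -- On `A`-modules, `A`-duality is `ω`-duality up to the factor `d⁻¹`, which cancels when dualizing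
  -- twice.
  have key : ∀ P : Submodule R K, Subalgebra.toSubmodule A * P = P →
      Subalgebra.toSubmodule A / P = Submodule.span R {d⁻¹} * (ω / P) := by
    intro P hP
    rw [← span_inv_mul_cancel hd (Subalgebra.toSubmodule A), ← h, span_mul_div (inv_ne_zero hd),
      div_div_eq, hP]
  rw [key _ (toSubmodule_mul_div_eq (toSubmodule_mul_self A).le),
    key J (toSubmodule_mul_eq_of_le hAJ), div_span_mul (inv_ne_zero hd),
    inv_inv, span_inv_mul_cancel hd, hω.div_div hJ]

variable [IsLocalRing R] [Module.Finite R (integralClosure R K)]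
  [IsDiscreteValuationRing (integralClosure R K)]

/-- If the overring `A` is Gorenstein, then its canonical ideal `ω : A` is principal. -/
theorem IsCanonicalIdeal.exists_div_eq_span_mul (hω : IsCanonicalIdeal R K ω)
    (hA : IsFrac R K (Subalgebra.toSubmodule A))
    (hAN : Subalgebra.toSubmodule A ≤ normalization R K) (hG : IsGorenstein A K) : ∃ c : K, c ≠ 0 ∧
      ω / Subalgebra.toSubmodule A = Submodule.span R {c} * Subalgebra.toSubmodule A := by
  rw [isGorenstein_iff hA] at hG
  obtain ⟨t, ht⟩ := IsDiscreteValuationRing.exists_irreducible (integralClosure R K)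
  have ht' : (t : K) ≠ 0 := by simpa using ht.ne_zero
  set Λ := Subalgebra.toSubmodule A with hΛ
  have hΛΛ : Λ * Λ = Λ := toSubmodule_mul_self A
  set C := ω / Λ with hC
  have hCf : IsFrac R K C := hω.isFrac.div hA
  have hΛC : Λ * C = C := by
    refine toSubmodule_mul_eq_of_le ?_
    rw [Submodule.le_div_iff_mul_le, mul_comm, ← mul_assoc, hΛΛ, mul_comm]
    exact div_mul_le _ _
  set D := Λ / C with hD
  set M := Submodule.span R {(t : K)} * normalization R K with hM
  have hCC : C / C = Λ := by
    conv_lhs => rw [hC]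
    rw [div_div_eq, ← hC, hΛC, hC, hω.div_div hA]
  -- `D : D = Λ : CD = (Λ : D) : C = C : C`, the Gorenstein property giving `Λ : D = C`.
  have hDD : D / D = Λ := by
    conv_lhs => rw [hD]
    rw [div_div_eq, ← hD, mul_comm, ← div_div_eq, hD, hG C hCf hΛC.le, hCC]
  -- If `CD ⊆ 𝔫 = Λ ∩ tR̄`, then `Λ : 𝔫 ⊆ Λ : CD = D : D = Λ`; dualizing again gives `𝔫 = Λ`,
  -- contradicting `1 ∉ tR̄`. An element `cd` outside `tR̄` is a unit of `Λ`, and `C = cΛ`.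
  have hex : ∃ c ∈ C, ∃ d ∈ D, c * d ∉ M := by
    by_contra! hcon
    have hCDM : C * D ≤ M := Submodule.mul_le.mpr hcon
    have hCDΛ : C * D ≤ Λ := by rw [mul_comm]; exact div_mul_le _ _
    have hn : IsFrac R K (Λ ⊓ M) := hA.inf ((isFrac_span ht').mul isFrac_normalization)
    have hΛn : Λ * (Λ ⊓ M) ≤ Λ ⊓ M := by
      refine le_inf ((mul_le_mul_of_le le_rfl inf_le_left).trans hΛΛ.le)
        ((mul_le_mul_of_le hAN inf_le_right).trans ?_)
      rw [hM, mul_left_comm, normalization_mul_self]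
    have hdiv : Λ / (Λ ⊓ M) = Λ := by
      refine le_antisymm ?_ (Submodule.le_div_iff_mul_le.mpr (hΛn.trans inf_le_left))
      refine (div_mono le_rfl (le_inf hCDΛ hCDM)).trans ?_
      rw [← div_div_eq, ← hD, hDD]
    have h1 := hG _ hn hΛn
    rw [hdiv, toSubmodule_div_self] at h1
    have h1M : (1 : K) ∈ M := by
      have : (1 : K) ∈ Λ := A.one_mem
      exact (h1.le this).2
    obtain ⟨y, hy, hty⟩ := mem_span_mul.mp h1M
    exact ht.not_isUnit (IsUnit.of_mul_eq_one ⟨y, hy⟩ (Subtype.ext hty))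
  obtain ⟨c, hc, d, hd, hcd⟩ := hex
  have hcdΛ : c * d ∈ Λ := by
    rw [mul_comm]; exact Submodule.mem_div_iff_forall_mul_mem.mp hd c hc
  have hcd0 : c * d ≠ 0 := fun h => hcd (h ▸ M.zero_mem)
  have hinvN : (c * d)⁻¹ ∈ normalization R K := by
    by_contra hnot
    obtain ⟨y, hy⟩ := exists_inv_eq_mul ht hnot
    rw [inv_inv] at hy
    exact hcd (mem_span_mul.mpr ⟨y, y.2, hy.symm⟩)
  have hinv : (c * d)⁻¹ ∈ Λ := inv_mem_of_mem_normalization A hcdΛ hinvN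
  refine ⟨c, left_ne_zero_of_mul hcd0, le_antisymm (fun z hz => ?_) ?_⟩
  · have hzd : d * z ∈ Λ := Submodule.mem_div_iff_forall_mul_mem.mp hd z hz
    refine mem_span_mul.mpr ⟨d * z * (c * d)⁻¹, A.mul_mem hzd hinv, ?_⟩
    have := left_ne_zero_of_mul hcd0
    have := right_ne_zero_of_mul hcd0
    field_simp
  · conv_rhs => rw [← hΛC, mul_comm]
    exact mul_le_mul_of_le (by simpa using hc) le_rfl

end GorensteinOverring

end CurveBlowup

namespace CurveBlowup

/-! ### Conductor lengths, the genus formula and the equivalences. -/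

section Main

variable {R : Type*} [CommRing R] [IsDomain R] [IsLocalRing R] [IsNoetherianRing R]
  [Ring.KrullDimLE 1 R] {K : Type*} [Field K] [Algebra R K] [IsFractionRing R K]
  [Module.Finite R (integralClosure R K)] [IsDiscreteValuationRing (integralClosure R K)]
  {ω : Submodule R K} {A : Subalgebra R K}

theorem toSubmodule_mul_normalization (hAN : Subalgebra.toSubmodule A ≤ normalization R K) :
    Subalgebra.toSubmodule A * normalization R K = normalization R K :=
  toSubmodule_mul_eq_of_le ((mul_le_mul_of_le hAN le_rfl).trans normalization_mul_self.le)

theorem toSubmodule_div_normalization_le :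
    Subalgebra.toSubmodule A / normalization R K ≤ Subalgebra.toSubmodule A := by
  have := div_mono (le_refl (Subalgebra.toSubmodule A)) (one_le_normalization (R := R) (K := K))
  rwa [div_one_eq] at this

/-- If `ω : A = dA`, the conductors satisfy `γ_R = d γ_A`. -/
theorem IsNormalizedCanonicalIdeal.conductorIdeal_eq_span_mul
    (hω : IsNormalizedCanonicalIdeal R K ω)
    (hAN : Subalgebra.toSubmodule A ≤ normalization R K) {d : K} (hd : d ≠ 0)
    (h : ω / Subalgebra.toSubmodule A = Submodule.span R {d} * Subalgebra.toSubmodule A) :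
    conductorIdeal R K =
      Submodule.span R {d} * (Subalgebra.toSubmodule A / normalization R K) := by
  rw [← hω.div_normalization, ← toSubmodule_mul_normalization hAN, ← div_div_eq, h,
    span_mul_div hd, toSubmodule_mul_normalization hAN]

theorem span_mul_div_le {d : K} {W J : Submodule R K} (h : Submodule.span R {d} * W ≤ W) :
    Submodule.span R {d} * (W / J) ≤ W / J := by
  rw [Submodule.le_div_iff_mul_le, mul_assoc]
  exact (mul_le_mul_of_le le_rfl (div_mul_le _ _)).trans h

/-- If `ω : A = dA`, then `ℓ(R̄ / γ_R) = ℓ(R̄ / γ_A) + ℓ(A / dA)`. -/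
theorem IsNormalizedCanonicalIdeal.lenNat_conductorIdeal
    (hω : IsNormalizedCanonicalIdeal R K ω) (hA : IsFrac R K (Subalgebra.toSubmodule A))
    (hAN : Subalgebra.toSubmodule A ≤ normalization R K) {d : K} (hd : d ≠ 0)
    (hdA : Submodule.span R {d} * Subalgebra.toSubmodule A ≤ Subalgebra.toSubmodule A)
    (h : ω / Subalgebra.toSubmodule A = Submodule.span R {d} * Subalgebra.toSubmodule A) :
    lenNat (normalization R K) (conductorIdeal R K) =
      lenNat (normalization R K) (Subalgebra.toSubmodule A / normalization R K) +
      lenNat (Subalgebra.toSubmodule A) (Submodule.span R {d} * Subalgebra.toSubmodule A) := by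
  have hN := isFrac_normalization (R := R) (K := K)
  have hγA := hA.div hN
  have hdγ := span_mul_div_le (J := normalization R K) hdA
  rw [lenNat_self_span_mul hd hA hγA hdA hdγ toSubmodule_div_normalization_le,
    hω.conductorIdeal_eq_span_mul hAN hd h, add_comm]
  exact lenNat_add hN ((isFrac_span hd).mul hγA) hdγ (toSubmodule_div_normalization_le.trans hAN)

/-- If `A` is Gorenstein, `dA ⊆ ω : A` and the colengths of the conductors differ by `ℓ(A / dA)`,
then `ω : A = dA`. -/
theorem IsNormalizedCanonicalIdeal.div_eq_of_isGorenstein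
    (hω : IsNormalizedCanonicalIdeal R K ω) (hA : IsFrac R K (Subalgebra.toSubmodule A))
    (hAN : Subalgebra.toSubmodule A ≤ normalization R K) (hG : IsGorenstein A K) {d : K}
    (hd : d ≠ 0) (hdA : Submodule.span R {d} * Subalgebra.toSubmodule A ≤ Subalgebra.toSubmodule A)
    (hle : Submodule.span R {d} * Subalgebra.toSubmodule A ≤ ω / Subalgebra.toSubmodule A)
    (hlen : lenNat (normalization R K) (conductorIdeal R K) =
      lenNat (normalization R K) (Subalgebra.toSubmodule A / normalization R K) +
      lenNat (Subalgebra.toSubmodule A) (Submodule.span R {d} * Subalgebra.toSubmodule A)) :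
    ω / Subalgebra.toSubmodule A = Submodule.span R {d} * Subalgebra.toSubmodule A := by
  obtain ⟨c, hc, hC⟩ := hω.1.exists_div_eq_span_mul hA hAN hG
  have hγ := hω.conductorIdeal_eq_span_mul hAN hc hC
  set Λ := Subalgebra.toSubmodule A with hΛ
  set γA := Λ / normalization R K with hγA
  have hN := isFrac_normalization (R := R) (K := K)
  have hγAf : IsFrac R K γA := hA.div hN
  have hγAΛ : γA ≤ Λ := toSubmodule_div_normalization_le
  have hΛγ : Λ * γA ≤ γA := (toSubmodule_mul_div_eq (toSubmodule_mul_self A).le).le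
  have hdmem : d ∈ Submodule.span R {c} * Λ := by
    rw [← hC]
    exact hle (mem_span_mul.mpr ⟨1, A.one_mem, mul_one d⟩)
  obtain ⟨u, hu, rfl⟩ := mem_span_mul.mp hdmem
  have hu0 : u ≠ 0 := right_ne_zero_of_mul hd
  have huΛ : Submodule.span R {u} ≤ Λ := by simpa using hu
  have hcu : ∀ P : Submodule R K, Submodule.span R {c * u} * P =
      Submodule.span R {c} * (Submodule.span R {u} * P) := fun P => by
    rw [← mul_assoc, Submodule.span_mul_span, Set.singleton_mul_singleton]
  have huΛΛ : Submodule.span R {u} * Λ ≤ Λ :=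
    (mul_le_mul_of_le huΛ le_rfl).trans (toSubmodule_mul_self A).le
  have huγ : Submodule.span R {u} * γA ≤ γA := (mul_le_mul_of_le huΛ le_rfl).trans hΛγ
  have hdγ := span_mul_div_le (J := normalization R K) hdA
  have hγγA : conductorIdeal R K ≤ γA := div_mono (one_le_toSubmodule A) le_rfl
  have hle1 : Submodule.span R {c * u} * γA ≤ conductorIdeal R K := by
    rw [hcu, hγ]
    exact mul_le_mul_of_le le_rfl huγ
  -- Writing `d = cu` with `u ∈ Λ`, `ℓ(cΛ/dΛ) = ℓ(Λ/uΛ) = ℓ(γ_A/uγ_A) = ℓ(γ_R/dγ_A)`. This vanishes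
  -- because the hypothesis gives `ℓ(γ_A/γ_R) = ℓ(Λ/dΛ) = ℓ(γ_A/dγ_A)`.
  have e1 : lenNat (ω / Λ) (Submodule.span R {c * u} * Λ) =
      lenNat (conductorIdeal R K) (Submodule.span R {c * u} * γA) := by
    rw [hC, hcu, lenNat_span_mul hc, lenNat_self_span_mul hu0 hA hγAf huΛΛ huγ hγAΛ, hcu, hγ,
      lenNat_span_mul hc]
  have e2 := lenNat_add hγAf ((isFrac_span hd).mul hγAf) hle1 hγγA
  have e3 := lenNat_add hN isFrac_conductorIdeal hγγA (hγAΛ.trans hAN)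
  have e4 := lenNat_self_span_mul hd hA hγAf hdA hdγ hγAΛ
  have hf := hω.1.isFrac.div hA
  refine eq_of_lenNat_eq_zero hf ((isFrac_span hd).mul hA) hle ?_
  omega

variable {I : Ideal R} {x : R}

theorem normalization_ne_one (hI : I ≠ ⊥) (h : IsMinimalReduction I x)
    (hprinc : ¬ Submodule.IsPrincipal I) : normalization R K ≠ 1 := fun hN =>
  blowupMod_ne_one hI h hprinc
    (le_antisymm (hN ▸ blowupMod_le_normalization hI h) (one_le_toSubmodule _))

theorem inK_pow_le_one_div_blowupMod (hI : I ≠ ⊥) (h : IsMinimalReduction I x) :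
    inK K (I ^ reductionExponent I x) ≤ 1 / blowupMod K I := by
  have hx0 := ne_zero_of_isMinimalReduction (K := K) hI h
  have hL := inK_pow_eq_span_mul_blowupMod h.1 hx0 (reductionExponent_spec h) _ le_rfl
  rw [Submodule.le_div_iff_mul_le]
  refine le_trans ?_ (inK_le_one (I ^ reductionExponent I x))
  rw [hL, mul_assoc, toSubmodule_mul_self]

/-- One copy of `ρ = ℓ(Λ/R)` is read off from `I^ν ⊆ Λ* ⊆ R ⊆ Λ`, the other from `R ⊆ Λ ⊆ Λ**`;
`lenNat_bidual` links the two chains. -/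
theorem two_mul_genus_add (hI : I ≠ ⊥) (h : IsMinimalReduction I x)
    (hprinc : ¬ Submodule.IsPrincipal I) (hω : IsNormalizedCanonicalIdeal R K ω)
    (hAG : IsAlmostGorenstein R K)
    (hres : Function.Surjective ((IsLocalRing.residue (integralClosure R K)).comp
      (algebraMap R (integralClosure R K)))) :
    2 * genus I + lenNat (1 / blowupMod K I) (inK K (I ^ reductionExponent I x)) +
      lenNat (1 / (1 / blowupMod K I)) (blowupMod K I) + 1 =
      idealMult I * reductionExponent I x + (cmType R K).toNat := by
  obtain ⟨-, h1, h2⟩ := isHPolynomial_and_idealMult_genus_eq K hI h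
  have hΛ := isFrac_blowupMod (K := K) hI h
  have h3 := hω.lenNat_bidual hAG hres (normalization_ne_one hI h hprinc) hΛ
    (blowupMod_ne_one hI h hprinc)
  have hL := isFrac_inK_pow (K := K) hI (reductionExponent I x)
  have hLJ := inK_pow_le_one_div_blowupMod (K := K) hI h
  have h1Λ : 1 ≤ blowupMod K I := one_le_toSubmodule _
  have hJ1 : 1 / blowupMod K I ≤ 1 := by
    have := div_mono (le_refl (1 : Submodule R K)) h1Λ
    rwa [div_one_eq] at this
  have e1 := lenNat_add hΛ hL (inK_le_one _) h1Λ
  have e2 := lenNat_add isFrac_one hL hLJ hJ1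
  have e3 := lenNat_add (isFrac_one.div (isFrac_one.div hΛ)) isFrac_one h1Λ
    (le_div_div 1 (blowupMod K I))
  rw [h1, h2]
  dsimp only [blowupMod] at *
  omega

theorem mul_blowupMod_of_one_div_eq (hI : I ≠ ⊥) (h : IsMinimalReduction I x)
    (hprinc : ¬ Submodule.IsPrincipal I) (hω : IsNormalizedCanonicalIdeal R K ω)
    (hAG : IsAlmostGorenstein R K)
    (hres : Function.Surjective ((IsLocalRing.residue (integralClosure R K)).comp
      (algebraMap R (integralClosure R K))))
    (hc : 1 / blowupMod K I = inK K (I ^ reductionExponent I x)) :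
    ω * blowupMod K I = blowupMod K I := by
  have hx0 := ne_zero_of_isMinimalReduction (K := K) hI h
  have := hω.mul_one_div hAG hres (normalization_ne_one hI h hprinc)
    (blowupMod_ne_one hI h hprinc)
  rw [hc, inK_pow_eq_span_mul_blowupMod h.1 hx0 (reductionExponent_spec h) _ le_rfl,
    mul_left_comm] at this
  exact span_mul_injective (pow_ne_zero _ hx0) this

theorem conditionsA_of_mul_blowupMod (hI : I ≠ ⊥) (h : IsMinimalReduction I x)
    (hω : IsNormalizedCanonicalIdeal R K ω) (hωΛ : ω * blowupMod K I = blowupMod K I) :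
    ConditionsA K I (reductionExponent I x) ω := by
  have hx0 := ne_zero_of_isMinimalReduction (K := K) hI h
  have a5 : ∀ n ≥ reductionExponent I x, ω * inK K (I ^ n) = inK K (I ^ n) := fun n hn => by
    rw [inK_pow_eq_span_mul_blowupMod h.1 hx0 (reductionExponent_spec h) n hn, mul_left_comm, hωΛ]
  -- The witness for (A₆) is `ν + 1`, which is positive even when `ν = 0`.
  refine ⟨?_, hωΛ, ?_, fun n hn => ?_, a5, reductionExponent I x + 1, Nat.succ_pos _,
    a5 _ (Nat.le_succ _)⟩
  · have := mul_le_mul_of_le (le_refl ω) (one_le_toSubmodule (blowup K I))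
    rwa [mul_one, hωΛ] at this
  · rw [hω.1.one_div, hωΛ]
  · rw [mul_comm, a5 n hn, inf_eq_left.mpr (inK_le_one _)]

end Main

end CurveBlowup

theorem theorem5p5 {R : Type*} [CommRing R] [IsDomain R] [IsLocalRing R] [IsNoetherianRing R]
    (hdim : ringKrullDim R = 1) [Infinite (IsLocalRing.ResidueField R)]
    {K : Type*} [Field K] [Algebra R K] [IsFractionRing R K]
    [Module.Finite R (integralClosure R K)] [IsDiscreteValuationRing (integralClosure R K)]
    (hres : Function.Surjective ((IsLocalRing.residue (integralClosure R K)).comp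
      (algebraMap R (integralClosure R K))))
    (hAG : IsAlmostGorenstein R K)
    (I : Ideal R) (hI : I.IsPrimary) (hIrad : I.radical = IsLocalRing.maximalIdeal R)
    (hIprinc : ¬ Submodule.IsPrincipal I) :
    -- the invariants are well defined, a minimal reduction and a canonical ideal exist
    ((∀ n, hilbertFn I n ≠ ⊤) ∧ IsHPolynomial I (hPolynomial I) ∧
      cmType R K ≠ ⊤ ∧ condLen R K ≠ ⊤ ∧ condLenBlowup K I ≠ ⊤ ∧
      (∃ x, IsMinimalReduction I x) ∧ ∃ ω, IsNormalizedCanonicalIdeal R K ω) ∧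
    ∀ (x : R) (ω : Submodule R K) (ν : ℕ), IsMinimalReduction I x →
      IsNormalizedCanonicalIdeal R K ω → ν = reductionExponent I x →
      len (starDual K (blowupMod K I)) (inK K (I ^ ν)) ≠ ⊤ ∧
      len (starDual K (starDual K (blowupMod K I))) (blowupMod K I) ≠ ⊤ ∧
      2 * genus I = idealMult I * ν + (cmType R K).toNat - 1
        - (len (starDual K (blowupMod K I)) (inK K (I ^ ν))).toNat
        - (len (starDual K (starDual K (blowupMod K I))) (blowupMod K I)).toNat ∧
      2 * genus I ≤ idealMult I * ν + (cmType R K).toNat - 1 ∧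
      List.TFAE [
        2 * genus I = idealMult I * ν + (cmType R K).toNat - 1,
        IsGorenstein (blowup K I) K ∧
          ((condLen R K).toNat : ℤ) - (condLenBlowup K I).toNat = idealMult I * ν,
        1 / blowupMod K I = inK K (I ^ ν),
        ω / blowupMod K I = inK K (I ^ ν)] ∧
      (2 * genus I = idealMult I * ν + (cmType R K).toNat - 1 → ConditionsA K I ν ω) := by
  have : Ring.KrullDimLE 1 R := (Order.krullDimLE_iff 1 _).mpr hdim.le
  have hI0 : I ≠ ⊥ := by
    rintro rfl
    have hbot : (⊥ : Ideal R).radical = ⊥ := Ideal.IsPrime.radical Ideal.isPrime_bot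
    rw [hbot] at hIrad
    have hfield := IsLocalRing.isField_iff_maximalIdeal_eq.mpr hIrad.symm
    rw [ringKrullDim_eq_zero_of_isField hfield] at hdim
    exact zero_ne_one hdim
  obtain ⟨x₀, hx₀⟩ := exists_isMinimalReduction K hI0
  have hne := normalization_ne_one (K := K) hI0 hx₀ hIprinc
  have hN := isFrac_normalization (R := R) (K := K)
  have hΛ := isFrac_blowupMod (K := K) hI0 hx₀
  have hΛN := blowupMod_le_normalization (K := K) hI0 hx₀
  refine ⟨⟨hilbertFn_ne_top K hI0, (isHPolynomial_and_idealMult_genus_eq K hI0 hx₀).1,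
    cmType_ne_top hres hne,
    hN.len_ne_top isFrac_conductorIdeal (conductorIdeal_le_one.trans one_le_normalization),
    hN.len_ne_top (hΛ.div hN) (toSubmodule_div_normalization_le.trans hΛN), ⟨x₀, hx₀⟩,
    exists_isNormalizedCanonicalIdeal hres⟩, ?_⟩
  rintro x ω ν hx hω rfl
  have hx0 := ne_zero_of_isMinimalReduction (K := K) hI0 hx
  have hL := inK_pow_eq_span_mul_blowupMod (K := K) hx.1 hx0 (reductionExponent_spec hx) _ le_rfl
  have hLf := isFrac_inK_pow (K := K) hI0 (reductionExponent I x)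
  have hLJ := inK_pow_le_one_div_blowupMod (K := K) hI0 hx
  have hbi := le_div_div 1 (blowupMod K I)
  have hform := two_mul_genus_add hI0 hx hIprinc hω hAG hres
  obtain ⟨-, heν, -⟩ := isHPolynomial_and_idealMult_genus_eq K hI0 hx
  set ν := reductionExponent I x with hν
  have hJf := isFrac_one.div hΛ
  have hd : algebraMap R K x ^ ν ≠ 0 := pow_ne_zero _ hx0
  have hdΛ : Submodule.span R {algebraMap R K x ^ ν} * blowupMod K I ≤ blowupMod K I :=
    hL ▸ (inK_le_one _).trans (one_le_toSubmodule _)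
  have ac : 2 * genus I = idealMult I * ν + (cmType R K).toNat - 1 →
      1 / blowupMod K I = inK K (I ^ ν) := fun ha =>
    eq_of_lenNat_eq_zero hJf hLf hLJ (by omega)
  have ca : 1 / blowupMod K I = inK K (I ^ ν) →
      2 * genus I = idealMult I * ν + (cmType R K).toNat - 1 := by
    intro hc
    -- `Λ* = dΛ` gives `Λ** = d⁻¹Λ* = Λ`, so the second correction term vanishes with the first.
    have h1 : 1 / (1 / blowupMod K I) = blowupMod K I := by
      conv_lhs => rw [hc, hL, div_span_mul hd, hc, hL, span_inv_mul_cancel hd]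
    rw [h1, hc, lenNat_self, lenNat_self] at hform
    push_cast at hform
    linarith
  have hA : 1 / blowupMod K I = inK K (I ^ ν) → ConditionsA K I ν ω := fun hc =>
    conditionsA_of_mul_blowupMod hI0 hx hω
      (mul_blowupMod_of_one_div_eq hI0 hx hIprinc hω hAG hres hc)
  refine ⟨hJf.len_ne_top hLf hLJ, (isFrac_one.div hJf).len_ne_top hΛ hbi, ?_, ?_, ?_,
    fun ha => hA (ac ha)⟩
  · change _ = _ - (lenNat _ _ : ℤ) - (lenNat _ _ : ℤ)
    linarith
  · linarith [Int.natCast_nonneg (lenNat (1 / blowupMod K I) (inK K (I ^ ν))),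
      Int.natCast_nonneg (lenNat (1 / (1 / blowupMod K I)) (blowupMod K I))]
  · tfae_have 1 → 3 := ac
    tfae_have 3 → 1 := ca
    tfae_have 3 → 4 := fun hc => (hA hc).a3.trans hc
    -- `I^ν ⊆ R : Λ ⊆ ω : Λ`, and the outer terms agree.
    tfae_have 4 → 3 := fun h4 => le_antisymm (h4 ▸ div_mono hω.2.1 le_rfl) hLJ
    tfae_have 4 → 2 := by
      intro h4
      rw [hL] at h4
      refine ⟨hω.1.isGorenstein_of_div_eq hΛ hd h4, ?_⟩
      have := hω.lenNat_conductorIdeal hΛ hΛN hd hdΛ h4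
      rw [heν, hL]
      change (lenNat _ _ : ℤ) - (lenNat _ _ : ℤ) = _
      dsimp only [blowupMod, conductorIdeal] at *
      omega
    tfae_have 2 → 4 := by
      rintro ⟨hG, hlen⟩
      rw [hL]
      refine hω.div_eq_of_isGorenstein hΛ hΛN hG hd hdΛ (hL ▸ hLJ.trans (div_mono hω.2.1 le_rfl)) ?_
      rw [heν, hL] at hlen
      change (lenNat _ _ : ℤ) - (lenNat _ _ : ℤ) = _ at hlen
      dsimp only [blowupMod] at *
      omega
    tfae_finish
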